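/- Let $\Gamma=\mathbb Z\mathbf r_1\oplus\mathbb Z\mathbf r_2$ with $\mathbf r_1=(\tfrac{\sqrt3}{2},\tfrac12)$, $\mathbf r_2=(\tfrac{\sqrt3}{2},-\tfrac12)$, let $\mathbf K=\tfrac{4\pi}{3}(0,1)$, let $R$ be the rotation of $\mathbb R^2$ by $2\pi/3$ and $\omega=e^{2\pi i/3}$; write $\langle f,g\rangle=\int_{\mathbb R^2/\Gamma}\overline f\,g$ and $\|\cdot\|$ for the inner product and norm of $L^2(\mathbb R^2/\Gamma)$. A real function has honeycomb symmetry if it is $\Gamma$-periodic, even and $R$-invariant. For $\sigma\in\mathbb C$ let $L^2_{\mathbf K,\sigma}$ be the set of $f\in L^2(\mathbb R^2/\Gamma)$ with $\widetilde Rf=\sigma f$, where $\widetilde Rf(\mathbf x)=e^{-i\mathbf K\cdot\mathbf x}e^{i\mathbf K\cdot R\mathbf x}f(R\mathbf x)$. Let $V_{NL}(\mathbf x,s)$ be a real function, smooth on $\mathbb R^2\times[0,\infty)$ and $\Gamma$-periodic in $\mathbf x$, with $V_{NL}(\mathbf x,s)=V_L(\mathbf x)+K(\mathbf x)s+O(s^2)$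 as $s\to0^+$, uniformly in $\mathbf x$, where $V_L$ and $K$ have honeycomb symmetry. Let $E_0$ be the lowest eigenvalue of $-(\nabla+i\mathbf K)^2+V_L$ on $H^2(\mathbb R^2/\Gamma)$, and suppose that its eigenspace is spanned by $\phi_0^a\in L^2_{\mathbf K,\omega}$ and $\phi_0^b\in L^2_{\mathbf K,\overline\omega}$ with $\|\phi_0^a\|=\|\phi_0^b\|=1$ and $\phi_0^a(\mathbf x)=\overline{\phi_0^b(-\mathbf x)}$. Put $I_{one}=\int_{\mathbb R^2/\Gamma}K|\phi_0^a|^4$, $I_{int}=\int_{\mathbb R^2/\Gamma}K|\phi_0^a|^2|\phi_0^b|^2$, and suppose $$\int_{\mathbb R^2/\Gamma}K\left(|\phi_0^a|^4-2|\phi_0^a|^2|\phi_0^b|^2\right)\ne0 .$$ Then for every constant $C_0$ there are $C>0$ and $\varepsilon_0>0$, depending only on $C_0$ and the data above, such that the following holds for all $0<\varepsilon<\varepsilon_0$. Let $\phi_t\in H^2(\mathbb R^2/\Gamma)$ satisfy $\|\phi_t\|<\varepsilon$, $\|\phi_t\|_{H^2}\le C_0\varepsilon$ and $$1-\frac{|\langle\phi_t,\phi_0^a\rangle|^2+|\langle\phi_t,\phi_0^b\rangle|^2}{\langle\phi_t,\phi_t\rangle}<\varepsilon^4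 ,$$ and let $\phi\in H^2(\mathbb R^2/\Gamma)$ be an eigenfunction of $H_t(\mathbf K)=-(\nabla+i\mathbf K)^2+V_{NL}(\mathbf x,|\phi_t(\mathbf x)|^2)$ with eigenvalue $E$, $|E-E_0|<\varepsilon$, such that $\langle\phi-\phi_t,\phi_0^a\rangle=\langle\phi-\phi_t,\phi_0^b\rangle=0$. Then $N=\left(|\langle\phi_0^a,\phi\rangle|^2+|\langle\phi_0^b,\phi\rangle|^2\right)^{1/2}>0$ and, with $a=\langle\phi_0^a,\phi\rangle/N$, $b=\langle\phi_0^b,\phi\rangle/N$ and $\delta=\left|C\varepsilon/(I_{one}-2I_{int})\right|^{1/3}>0$, $$|a|<\delta\quad\text{or}\quad|b|<\delta\quad\text{or}\quad\bigl||a|^2-|b|^2\bigr|<\delta .$$ -/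

import Mathlib

open MeasureTheory Set
open scoped ContDiff ComplexConjugate

noncomputable section

namespace Honeycomb

/-- The plane `ℝ²` with its Euclidean structure. -/
abbrev Plane : Type := EuclideanSpace ℝ (Fin 2)

/-! ### The honeycomb lattice -/

/-- First primitive vector of the lattice `Γ`. -/
def r₁ : Plane := !₂[√3 / 2, 1 / 2]

/-- Second primitive vector of the lattice `Γ`. -/
def r₂ : Plane := !₂[√3 / 2, -(1 / 2)]

/-- The Dirac point `K = (4π/3) (0, 1)`. -/
def Kpt : Plane := !₂[0, 4 * Real.pi / 3]

/-- The rotation matrix `R` (by the angle `2π/3`), as a map of the plane. -/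
def rot (x : Plane) : Plane :=
  !₂[-(1 / 2) * x 0 - √3 / 2 * x 1, √3 / 2 * x 0 - 1 / 2 * x 1]

/-- The cube root of unity `ω = exp(2πi/3)`. -/
def omega : ℂ := Complex.exp (2 * Real.pi * Complex.I / 3)

/-- Fundamental cell of `ℝ²/Γ`. -/
def cell : Set Plane :=
  {x | ∃ s ∈ Ico (0 : ℝ) 1, ∃ t ∈ Ico (0 : ℝ) 1, x = s • r₁ + t • r₂}

/-- `Γ`-periodicity; functions on the torus `ℝ²/Γ` are the `Γ`-periodic functions on the plane. -/
def LatticePeriodic {α : Type} (f : Plane → α) : Prop :=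
  (∀ x, f (x + r₁) = f x) ∧ ∀ x, f (x + r₂) = f x

/-- Honeycomb symmetry of a real function: `Γ`-periodic, even, and invariant under `R`. -/
structure IsHoneycomb (V : Plane → ℝ) : Prop where
  periodic : LatticePeriodic V
  even : ∀ x, V (-x) = V x
  rot_invariant : ∀ x, V (rot x) = V x

/-! ### `L²(ℝ²/Γ)` -/

/-- `f ∈ L²(ℝ²/Γ)`. -/
def MemL2 (f : Plane → ℂ) : Prop :=
  LatticePeriodic f ∧ MemLp f 2 (volume.restrict cell)

/-- The inner product of `L²(ℝ²/Γ)`, conjugate-linear in the first argument. -/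
def inner2 (f g : Plane → ℂ) : ℂ := ∫ x in cell, conj (f x) * g x

/-- The norm of `L²(ℝ²/Γ)`. -/
def norm2 (f : Plane → ℂ) : ℝ := √(∫ x in cell, ‖f x‖ ^ 2)

/-! ### `H²(ℝ²/Γ)` through weak derivatives -/

/-- `g ∈ L²(ℝ²/Γ)` is the weak partial derivative `∂ᵢ f` on the torus: the test functions are the
smooth functions on `ℝ²/Γ`. -/
def IsWeakPartial (i : Fin 2) (f g : Plane → ℂ) : Prop :=
  MemL2 g ∧ ∀ η : Plane → ℂ, ContDiff ℝ ∞ η → LatticePeriodic η →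
    ∫ x in cell, f x * fderiv ℝ η x (EuclideanSpace.single i 1) = -∫ x in cell, g x * η x

open Classical in
/-- The weak partial derivative `∂ᵢ f` (unique almost everywhere when it exists, `0` if there is
none). -/
def weakPartial (i : Fin 2) (f : Plane → ℂ) : Plane → ℂ :=
  if h : ∃ g, IsWeakPartial i f g then h.choose else 0

/-- `f ∈ H²(ℝ²/Γ)`. -/
structure MemH2 (f : Plane → ℂ) : Prop where
  memL2 : MemL2 f
  first : ∀ i, ∃ g, IsWeakPartial i f g
  second : ∀ i j, ∃ g, IsWeakPartial j (weakPartial i f) g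

/-- The norm of `H²(ℝ²/Γ)`. -/
def normH2 (f : Plane → ℂ) : ℝ :=
  √(norm2 f ^ 2 + ∑ i, norm2 (weakPartial i f) ^ 2
    + ∑ i, ∑ j, norm2 (weakPartial j (weakPartial i f)) ^ 2)

/-! ### The Hamiltonians at the Dirac point -/

/-- `Δ_K f = (∇ + iK)² f = ∑ᵢ (∂ᵢ∂ᵢ f + 2i Kᵢ ∂ᵢ f - Kᵢ² f)`. -/
def laplaceK (f : Plane → ℂ) (x : Plane) : ℂ :=
  ∑ i, (weakPartial i (weakPartial i f) x + 2 * Complex.I * (Kpt i : ℂ) * weakPartial i f x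
    - (Kpt i : ℂ) ^ 2 * f x)

/-- `f ∈ H²(ℝ²/Γ)` is an eigenfunction, with eigenvalue `E`, of `-(∇ + iK)² + W`. -/
structure IsEigenfunction (W : Plane → ℝ) (E : ℂ) (f : Plane → ℂ) : Prop where
  memH2 : MemH2 f
  ne_zero : ¬ f =ᵐ[volume] 0
  eqn : ∀ᵐ x ∂(volume : Measure Plane), -laplaceK f x + (W x : ℂ) * f x = E * f x

/-- The transformed rotation `R̃ f = e^{-iK·x} [e^{iK·(·)} f](R x)`. -/
def rotOp (f : Plane → ℂ) (x : Plane) : ℂ :=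
  Complex.exp (-(Complex.I * (inner ℝ Kpt x : ℝ))) *
    (Complex.exp (Complex.I * (inner ℝ Kpt (rot x) : ℝ)) * f (rot x))

/-- The subspace `L²_{K,σ}` of `L²(ℝ²/Γ)` on which `R̃` acts as `σ`. -/
def MemRotSpace (σ : ℂ) (f : Plane → ℂ) : Prop :=
  MemL2 f ∧ ∀ᵐ x ∂(volume : Measure Plane), rotOp f x = σ * f x

/-- `E₀` is the lowest eigenvalue of `-(∇ + iK)² + V_L`, its eigenspace is spanned by the normalized
functions `φa ∈ L²_{K,ω}` and `φb ∈ L²_{K,ω̄}`, and `φa(x)` is the conjugate of `φb(-x)`. -/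
structure IsGroundPair (VL : Plane → ℝ) (E₀ : ℝ) (φa φb : Plane → ℂ) : Prop where
  eigen_a : IsEigenfunction VL E₀ φa
  eigen_b : IsEigenfunction VL E₀ φb
  lowest : ∀ (μ : ℝ) (f : Plane → ℂ), IsEigenfunction VL μ f → E₀ ≤ μ
  span : ∀ f : Plane → ℂ, IsEigenfunction VL E₀ f →
    ∃ a b : ℂ, f =ᵐ[volume] fun x => a * φa x + b * φb x
  norm_a : norm2 φa = 1
  norm_b : norm2 φb = 1
  rot_a : MemRotSpace omega φa
  rot_b : MemRotSpace (conj omega) φb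
  reflect : ∀ᵐ x ∂(volume : Measure Plane), φa x = conj (φb (-x))

/-- `V_NL(x, s)` is a `Γ`-periodic function, smooth on `ℝ² × [0, ∞)`, with an expansion
`V_NL(x, s) = V_L(x) + K(x) s + O(s²)` as `s → 0+`, uniformly in `x`; `V_L` and `K` have honeycomb
symmetry. -/
structure IsNonlinearPotential (V : Plane → ℝ → ℝ) (VL K : Plane → ℝ) : Prop where
  smooth : ContDiffOn ℝ ∞ (fun p : Plane × ℝ => V p.1 p.2) (univ ×ˢ Ici 0)
  periodic : ∀ s, 0 ≤ s → LatticePeriodic fun x => V x s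
  honeycomb_linear : IsHoneycomb VL
  honeycomb_kerr : IsHoneycomb K
  expansion : ∃ r > 0, ∃ C, ∀ x, ∀ s ∈ Icc (0 : ℝ) r, |V x s - (VL x + K x * s)| ≤ C * s ^ 2

/-- `I_one = ∫ K |φa|⁴`. -/
def Ione (K : Plane → ℝ) (φa : Plane → ℂ) : ℝ := ∫ x in cell, K x * ‖φa x‖ ^ 4

/-- `I_int = ∫ K |φa|² |φb|²`. -/
def Iint (K : Plane → ℝ) (φa φb : Plane → ℂ) : ℝ :=
  ∫ x in cell, K x * (‖φa x‖ ^ 2 * ‖φb x‖ ^ 2)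

/-- The length of the coefficient vector `(⟨φa, φ⟩, ⟨φb, φ⟩)`. -/
def coeffNorm (φa φb φ : Plane → ℂ) : ℝ := √(‖inner2 φa φ‖ ^ 2 + ‖inner2 φb φ‖ ^ 2)

/-- First normalized coefficient `a` of `φ`, so that `|a|² + |b|² = 1`. -/
def coeffA (φa φb φ : Plane → ℂ) : ℂ := inner2 φa φ / (coeffNorm φa φb φ : ℂ)

/-- Second normalized coefficient `b` of `φ`. -/
def coeffB (φa φb φ : Plane → ℂ) : ℂ := inner2 φb φ / (coeffNorm φa φb φ : ℂ)

end Honeycomb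

end

/-! Let `u = αφa + βφb` be the projection of `φ` to the ground eigenspace, with `α = ⟨φa, φ⟩` and `β
= ⟨φb, φ⟩`, so that `‖u‖ = N`. By the orthogonality conditions `φt` has the same projection. Hence
`‖φt - u‖² = ‖φt‖² - N²`, which the concentration hypothesis bounds by `2ε⁴N²`.

The perturbation `V(x,|φt|²) - VL` is `O(ε²)` uniformly, because the `H²` bound on `φt` gives a sup
bound (`exists_sobolev_bound`). To exploit this, put `g = (1 - Δ_K)φ` and `G = (1 - Δ_K)⁻¹`. The
eigenvalue equation becomes `g + A G g = (E - E₀) G g - w`, where `A` multiplies by `VL - 1 - E₀`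
and `w` is the perturbation times `φ` (`IsEigenfunction.source_eq`). Since `G` is compact, `1 + A G`
is bounded below off the ground eigenspace (`exists_gap`), so `φ - u = O(ε² N)` in the sup norm
(`perturbed_eigenvector` with the Sobolev bound).

Pairing the equation with `φa` and `φb` gives `(E - E₀)α = ⟨φa, w⟩` and `(E - E₀)β = ⟨φb, w⟩`. Here
`w` may be replaced by `K|u|²u` with error `O(ε² N³)`. The error has to be cubic in `N`, not in `ε`,
because `N` has no lower bound in terms of `ε`. Rotation symmetry kills every quartic integral of
nontrivial charge (`integral_kerr_term`), which leaves `(E - E₀)α = α(|α|² I_one + 2|β|² I_int) +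
O(ε² N³)` and the same equation with `α` and `β` exchanged.

Eliminating `E - E₀` between the two yields `αβ(|α|² - |β|²)(I_one - 2 I_int) = O(ε² N⁴)`
(`amplitude_bound`). After division by `N⁴` the product of three nonnegative numbers is below `δ³`,
so one of them is below `δ`. -/

noncomputable section

namespace Honeycomb

/-! ### The lattice and its fundamental cell -/

/-- Coordinates of a point of the plane with respect to `r₁`, `r₂`. -/
def latticeCoord : Plane ≃ₗ[ℝ] (Fin 2 → ℝ) where
  toFun x := ![x 0 / √3 + x 1, x 0 / √3 - x 1]
  invFun c := c 0 • r₁ + c 1 • r₂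
  map_add' x y := by ext i; fin_cases i <;> simp <;> ring
  map_smul' a x := by ext i; fin_cases i <;> simp <;> ring
  left_inv x := by
    have h3 : √3 ≠ 0 := by positivity
    ext i; fin_cases i <;> simp [r₁, r₂] <;> field_simp <;> ring
  right_inv c := by
    have h3 : √3 ≠ 0 := by positivity
    ext i; fin_cases i <;> simp [r₁, r₂] <;> field_simp <;> ring

/-- The basis `r₁`, `r₂` of the plane. -/
def latticeBasis : Module.Basis (Fin 2) ℝ Plane := Module.Basis.ofEquivFun latticeCoord

@[simp] lemma latticeBasis_zero : latticeBasis 0 = r₁ := by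
  simp [latticeBasis, Module.Basis.coe_ofEquivFun, latticeCoord]

@[simp] lemma latticeBasis_one : latticeBasis 1 = r₂ := by
  simp [latticeBasis, Module.Basis.coe_ofEquivFun, latticeCoord]

lemma latticeBasis_repr (x : Plane) (i : Fin 2) : latticeBasis.repr x i = latticeCoord x i := by
  rw [latticeBasis, Module.Basis.ofEquivFun_repr_apply]

/-- The lattice `Γ`. -/
abbrev lattice : Submodule ℤ Plane := Submodule.span ℤ (range latticeBasis)

lemma mem_lattice (m n : ℤ) : m • r₁ + n • r₂ ∈ lattice := by
  have h1 : r₁ ∈ lattice := Submodule.subset_span ⟨0, latticeBasis_zero⟩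
  have h2 : r₂ ∈ lattice := Submodule.subset_span ⟨1, latticeBasis_one⟩
  exact add_mem (zsmul_mem h1 m) (zsmul_mem h2 n)

/-- This makes the theory of fundamental domains available: measurability, boundedness, and
independence of integrals from the choice of domain. -/
lemma cell_eq : cell = ZSpan.fundamentalDomain latticeBasis := by
  ext x
  simp only [cell, ZSpan.mem_fundamentalDomain, mem_ofPred_eq, latticeBasis_repr, Fin.forall_fin_two]
  constructor
  · rintro ⟨s, hs, t, ht, rfl⟩
    have : latticeCoord (s • r₁ + t • r₂) = ![s, t] := latticeCoord.right_inv ![s, t]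
    simpa [this] using ⟨hs, ht⟩
  · rintro ⟨h0, h1⟩
    exact ⟨_, h0, _, h1, (latticeCoord.left_inv x).symm⟩

lemma isAddFundamentalDomain_cell : IsAddFundamentalDomain lattice cell (volume : Measure Plane) := by
  rw [cell_eq]; exact ZSpan.isAddFundamentalDomain latticeBasis volume

lemma measurableSet_cell : MeasurableSet cell := by
  rw [cell_eq]; exact ZSpan.fundamentalDomain_measurableSet _

lemma isBounded_cell : Bornology.IsBounded cell := by
  rw [cell_eq]; exact ZSpan.fundamentalDomain_isBounded _

lemma volume_cell_lt_top : (volume : Measure Plane) cell < ⊤ := isBounded_cell.measure_lt_top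

lemma volume_cell_ne_zero : (volume : Measure Plane) cell ≠ 0 := by
  rw [cell_eq]; exact ZSpan.measure_fundamentalDomain_ne_zero _

instance : VAddInvariantMeasure lattice Plane volume :=
  inferInstanceAs (VAddInvariantMeasure lattice.toAddSubgroup Plane volume)

instance : IsFiniteMeasure ((volume : Measure Plane).restrict cell) :=
  ⟨by simpa using volume_cell_lt_top⟩

lemma LatticePeriodic.add_mem {α : Type} {f : Plane → α} (hf : LatticePeriodic f) {w : Plane}
    (hw : w ∈ lattice) (x : Plane) : f (x + w) = f x := by
  have : Function.Periodic f w := by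
    induction hw using Submodule.span_induction with
    | mem w h =>
      obtain ⟨i, rfl⟩ := h
      fin_cases i
      · simpa using hf.1
      · simpa using hf.2
    | zero => intro x; simp
    | add a b _ _ ha hb => exact ha.add_period hb
    | smul n a _ ha => exact ha.zsmul n
  exact this x

lemma LatticePeriodic.vadd {α : Type} {f : Plane → α} (hf : LatticePeriodic f) (g : lattice)
    (x : Plane) : f (g +ᵥ x) = f x := by
  rw [Submodule.vadd_def, vadd_eq_add, add_comm]; exact hf.add_mem g.2 x

lemma LatticePeriodic.fract {α : Type} {f : Plane → α} (hf : LatticePeriodic f) (x : Plane) :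
    f (ZSpan.fract latticeBasis x) = f x := by
  rw [ZSpan.fract_apply, sub_eq_add_neg]
  exact hf.add_mem (neg_mem (ZSpan.floor latticeBasis x).2) x

lemma latticePeriodic_comp_fract {α : Type} (f : Plane → α) :
    LatticePeriodic fun x => f (ZSpan.fract latticeBasis x) := by
  constructor <;> intro x <;> dsimp only <;> rw [ZSpan.fract_add_ZSpan] <;>
    first
      | simpa using mem_lattice 1 0
      | simpa using mem_lattice 0 1

lemma fract_of_mem_cell {x : Plane} (hx : x ∈ cell) : ZSpan.fract latticeBasis x = x := by
  rw [ZSpan.fract_eq_self, ← cell_eq]; exact hx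

lemma fract_mem_cell (x : Plane) : ZSpan.fract latticeBasis x ∈ cell := by
  rw [cell_eq]; exact ZSpan.fract_mem_fundamentalDomain _ x

/-- A periodic property that holds almost everywhere on the cell holds almost everywhere. -/
lemma ae_of_ae_cell {p : Plane → Prop} (hp : LatticePeriodic p)
    (h : ∀ᵐ x ∂(volume : Measure Plane).restrict cell, p x) :
    ∀ᵐ x ∂(volume : Measure Plane), p x := by
  refine isAddFundamentalDomain_cell.measure_zero_of_invariant {x | ¬ p x} (fun g => ?_) ?_
  · ext x
    rw [mem_vadd_set_iff_neg_vadd_mem]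
    simp only [mem_ofPred_eq, hp.vadd]
  · rw [ae_restrict_iff' measurableSet_cell, ae_iff] at h
    convert h using 2
    ext x; simp [and_comm]

/-- If `T` intertwines the lattice action up to an automorphism `e`, then `T ⁻¹' cell` is again a
fundamental domain, and a periodic function has the same integral over any two of them.
Translations, `x ↦ -x` and `R` are all of this kind. -/
lemma setIntegral_preimage_cell {E : Type*} [NormedAddCommGroup E] [NormedSpace ℝ E]
    {f : Plane → E} (hf : ∀ (g : lattice) (x : Plane), f (g +ᵥ x) = f x)
    (T : Plane ≃ᵐ Plane) (hT : MeasurePreserving T) (e : lattice ≃ lattice)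
    (he : ∀ (g : lattice) (x : Plane), T (e g +ᵥ x) = g +ᵥ T x) :
    ∫ x in cell, f (T x) = ∫ x in cell, f x := by
  have h1 : IsAddFundamentalDomain lattice (T ⁻¹' cell) (volume : Measure Plane) :=
    isAddFundamentalDomain_cell.preimage_of_equiv hT.quasiMeasurePreserving e.bijective
      (fun g x => he g x)
  have hfT : ∀ (g : lattice) (x : Plane), f (T (g +ᵥ x)) = f (T x) := fun g x => by
    obtain ⟨g, rfl⟩ := e.surjective g
    rw [he, hf]
  rw [isAddFundamentalDomain_cell.setIntegral_eq h1 (f := fun x => f (T x)) hfT,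
    hT.setIntegral_preimage_emb T.measurableEmbedding]

/-- Integrals of periodic functions over the cell are translation invariant. -/
lemma setIntegral_cell_add {E : Type} [NormedAddCommGroup E] [NormedSpace ℝ E]
    {f : Plane → E} (hf : LatticePeriodic f) (v : Plane) :
    ∫ x in cell, f (x + v) = ∫ x in cell, f x :=
  setIntegral_preimage_cell hf.vadd (MeasurableEquiv.addRight v)
    (measurePreserving_add_right volume v) (Equiv.refl _)
    (fun g x => by simp [Submodule.vadd_def, add_assoc])

/-- Integrals of periodic functions over the cell are invariant under `x ↦ -x`. -/
lemma setIntegral_cell_neg {E : Type} [NormedAddCommGroup E] [NormedSpace ℝ E]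
    {f : Plane → E} (hf : LatticePeriodic f) :
    ∫ x in cell, f (-x) = ∫ x in cell, f x :=
  setIntegral_preimage_cell hf.vadd (MeasurableEquiv.neg Plane)
    (Measure.measurePreserving_neg volume) (Equiv.neg _)
    (fun g x => by simp [Submodule.vadd_def, add_comm])

/-- The rotation `R` as a linear equivalence. -/
def rotEquiv : Plane ≃ₗ[ℝ] Plane where
  toFun := rot
  invFun x := rot (rot x)
  map_add' x y := by ext i; fin_cases i <;> simp [rot] <;> ring
  map_smul' a x := by ext i; fin_cases i <;> simp [rot] <;> ring
  left_inv x := by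
    have h3 : √3 ^ 2 = 3 := by simp
    have h4 : √3 ^ 3 = 3 * √3 := by rw [pow_succ, h3]
    ext i; fin_cases i <;> simp [rot] <;> ring_nf <;> simp only [h3, h4] <;> ring
  right_inv x := by
    have h3 : √3 ^ 2 = 3 := by simp
    have h4 : √3 ^ 3 = 3 * √3 := by rw [pow_succ, h3]
    ext i; fin_cases i <;> simp [rot] <;> ring_nf <;> simp only [h3, h4] <;> ring

/-- The rotation `R` as a linear isometry. -/
def rotIsometry : Plane ≃ₗᵢ[ℝ] Plane where
  toLinearEquiv := rotEquiv
  norm_map' x := by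
    have h3 : √3 ^ 2 = 3 := by simp
    rw [EuclideanSpace.norm_eq, EuclideanSpace.norm_eq]
    congr 1
    simp [rotEquiv, rot, Fin.sum_univ_two]
    ring_nf; simp only [h3]; ring

lemma rotIsometry_apply (x : Plane) : rotIsometry x = rot x := rfl

lemma rot_r₁ : rot r₁ = -r₂ := by
  have h3 : √3 ^ 2 = 3 := by simp
  ext i; fin_cases i <;> simp [rot, r₁, r₂] <;> ring_nf; simp only [h3]; ring

lemma rot_r₂ : rot r₂ = r₁ - r₂ := by
  have h3 : √3 ^ 2 = 3 := by simp
  ext i; fin_cases i <;> simp [rot, r₁, r₂] <;> ring_nf; simp only [h3]; ring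

lemma rot_mem_lattice {w : Plane} (hw : w ∈ lattice) : rot w ∈ lattice := by
  have h1 : r₁ ∈ lattice := by simpa using mem_lattice 1 0
  have h2 : r₂ ∈ lattice := by simpa using mem_lattice 0 1
  rw [← rotIsometry_apply]
  induction hw using Submodule.span_induction with
  | mem w h =>
    obtain ⟨i, rfl⟩ := h
    rw [rotIsometry_apply]
    fin_cases i
    · simpa [rot_r₁] using h2
    · simpa [rot_r₂] using sub_mem h1 h2
  | zero => simp
  | add a b _ _ ha hb => rw [map_add]; exact add_mem ha hb
  | smul n a _ ha => rw [map_zsmul]; exact zsmul_mem ha n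

/-- Integrals of periodic functions over the cell are invariant under `R`. -/
lemma setIntegral_cell_rot {E : Type} [NormedAddCommGroup E] [NormedSpace ℝ E]
    {f : Plane → E} (hf : LatticePeriodic f) :
    ∫ x in cell, f (rot x) = ∫ x in cell, f x := by
  refine setIntegral_preimage_cell hf.vadd rotIsometry.toMeasurableEquiv
    rotIsometry.measurePreserving
    -- The inverse rotation is `R²`, hence the two applications of `rot_mem_lattice`.
    ⟨fun g => ⟨rotIsometry.symm g, rot_mem_lattice (rot_mem_lattice g.2)⟩,
      fun g => ⟨rotIsometry g, rot_mem_lattice g.2⟩, fun g => by simp, fun g => by simp⟩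
    (fun g x => by simp [Submodule.vadd_def])

/-! ### Plane waves -/

/-- The dual lattice vector with index `k`. -/
def waveVector (k : Fin 2 → ℤ) : Plane :=
  !₂[2 * Real.pi * (k 0 + k 1) / √3, 2 * Real.pi * (k 0 - k 1)]

/-- The plane wave with index `k`. -/
def wave (k : Fin 2 → ℤ) (x : Plane) : ℂ :=
  Complex.exp (Complex.I * (inner ℝ (waveVector k) x : ℝ))

/-- The wave vectors pair with `r₁`, `r₂` to integer multiples of `2π`, so in lattice coordinates
the waves are the standard characters of the torus. -/
lemma wave_eq_latticeCoord (k : Fin 2 → ℤ) (x : Plane) :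
    wave k x = Complex.exp (2 * Real.pi * Complex.I *
      (k 0 * latticeCoord x 0 + k 1 * latticeCoord x 1)) := by
  rw [wave]
  congr 1
  simp [waveVector, latticeCoord, PiLp.inner_apply, Fin.sum_univ_two]
  ring

lemma inner_waveVector_add (k l : Fin 2 → ℤ) :
    waveVector (k + l) = waveVector k + waveVector l := by
  ext i; fin_cases i <;> simp [waveVector] <;> ring

lemma wave_add (k : Fin 2 → ℤ) (x y : Plane) : wave k (x + y) = wave k x * wave k y := by
  simp only [wave, inner_add_right, Complex.ofReal_add, mul_add, Complex.exp_add]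

lemma wave_index_add (k l : Fin 2 → ℤ) (x : Plane) : wave (k + l) x = wave k x * wave l x := by
  simp only [wave, inner_waveVector_add, inner_add_left, Complex.ofReal_add, mul_add,
    Complex.exp_add]

lemma waveVector_neg (k : Fin 2 → ℤ) : waveVector (-k) = -waveVector k := by
  ext i; fin_cases i <;> simp [waveVector] <;> ring

lemma conj_wave (k : Fin 2 → ℤ) (x : Plane) : conj (wave k x) = wave (-k) x := by
  simp only [wave, ← Complex.exp_conj, waveVector_neg, inner_neg_left, map_mul, Complex.conj_I,
    Complex.conj_ofReal, Complex.ofReal_neg]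
  congr 1; ring

lemma norm_wave (k : Fin 2 → ℤ) (x : Plane) : ‖wave k x‖ = 1 := by
  rw [wave, mul_comm, Complex.norm_exp_ofReal_mul_I]

lemma wave_zero (x : Plane) : wave 0 x = 1 := by
  have : waveVector 0 = 0 := by ext i; fin_cases i <;> simp [waveVector]
  simp [wave, this]

lemma contDiff_wave (k : Fin 2 → ℤ) : ContDiff ℝ ∞ (wave k) := by
  have h : ContDiff ℝ ∞ fun x : Plane => Complex.ofRealCLM (inner ℝ (waveVector k) x) :=
    Complex.ofRealCLM.contDiff.comp (contDiff_const.inner ℝ contDiff_id)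
  exact (contDiff_const.mul h).cexp

lemma latticePeriodic_wave (k : Fin 2 → ℤ) : LatticePeriodic (wave k) := by
  have h : ∀ m : ℤ, Complex.exp (2 * Real.pi * Complex.I * m) = 1 := fun m => by
    rw [mul_comm]; exact Complex.exp_int_mul_two_pi_mul_I m
  have h1 : latticeCoord r₁ = ![1, 0] := by
    have := latticeCoord.right_inv ![1, 0]
    simpa [latticeCoord] using this
  have h2 : latticeCoord r₂ = ![0, 1] := by
    have := latticeCoord.right_inv ![0, 1]
    simpa [latticeCoord] using this
  constructor <;> intro x
  · simp [wave_add, wave_eq_latticeCoord k r₁, h1, h]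
  · simp [wave_add, wave_eq_latticeCoord k r₂, h2, h]

lemma fderiv_wave (k : Fin 2 → ℤ) (x : Plane) (i : Fin 2) :
    fderiv ℝ (wave k) x (EuclideanSpace.single i 1)
      = Complex.I * (waveVector k i : ℂ) * wave k x := by
  have h1 : HasFDerivAt (fun y : Plane => Complex.I * ((inner ℝ (waveVector k) y : ℝ) : ℂ))
      (Complex.I • (Complex.ofRealCLM.comp (innerSL ℝ (waveVector k)))) x :=
    ((Complex.ofRealCLM.comp (innerSL ℝ (waveVector k))).hasFDerivAt).const_mul Complex.I
  have h2 := h1.cexp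
  have h3 : fderiv ℝ (wave k) x = _ := h2.fderiv
  rw [h3]
  simp [wave, EuclideanSpace.inner_single_right]
  ring

/-! ### Comparison with the standard torus -/

local instance : MeasureSpace UnitAddCircle := ⟨AddCircle.haarAddCircle⟩

local instance : Measure.IsAddHaarMeasure (volume : Measure UnitAddCircle) :=
  inferInstanceAs (Measure.IsAddHaarMeasure AddCircle.haarAddCircle)

local instance : IsProbabilityMeasure (volume : Measure UnitAddCircle) :=
  inferInstanceAs (IsProbabilityMeasure AddCircle.haarAddCircle)

/-- The representative in the plane of a point of the standard torus. -/
def torusToPlane (z : UnitAddTorus (Fin 2)) : Plane :=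
  latticeCoord.symm (fun i => (AddCircle.equivIoc 1 0 (z i) : ℝ))

lemma mFourier_eq_wave (k : Fin 2 → ℤ) (z : UnitAddTorus (Fin 2)) :
    UnitAddTorus.mFourier k z = wave k (torusToPlane z) := by
  have h : z = fun i => ((AddCircle.equivIoc 1 0 (z i) : ℝ) : UnitAddCircle) := by
    ext i; exact AddCircle.coe_equivIoc.symm
  rw [wave_eq_latticeCoord, torusToPlane, LinearEquiv.apply_symm_apply]
  conv_lhs => rw [h]
  simp only [UnitAddTorus.mFourier, ContinuousMap.coe_mk, Fin.prod_univ_two, fourier_coe_apply]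
  rw [← Complex.exp_add]
  congr 1
  push_cast
  ring

/-- The image of Lebesgue measure under a linear isomorphism is a Haar measure. Only `c ≠ 0` matters
later, not its value. -/
lemma map_latticeCoord_symm :
    ∃ c : NNReal, c ≠ 0 ∧
      Measure.map latticeCoord.symm (volume : Measure (Fin 2 → ℝ))
        = c • (volume : Measure Plane) := by
  have : (Measure.map latticeCoord.symm (volume : Measure (Fin 2 → ℝ))).IsAddHaarMeasure :=
    latticeCoord.symm.toContinuousLinearEquiv.isAddHaarMeasure_map volume
  refine ⟨_, (Measure.addHaarScalarFactor_pos_of_isAddHaarMeasure _ _).ne',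
    Measure.isAddLeftInvariant_eq_smul _ _⟩

/-- The cell uses intervals `[0,1)` while the torus representatives lie in `(0,1]`; the two boxes
differ by a null set. -/
lemma preimage_cell_ae_eq :
    (latticeCoord.symm ⁻¹' cell : Set (Fin 2 → ℝ)) =ᵐ[volume]
      {x : Fin 2 → ℝ | ∀ i, x i ∈ Ioc ((0 : Fin 2 → ℝ) i) ((0 : Fin 2 → ℝ) i + 1)} := by
  have h1 : (latticeCoord.symm ⁻¹' cell : Set (Fin 2 → ℝ))
      = univ.pi fun i => Ico ((0 : Fin 2 → ℝ) i) ((0 : Fin 2 → ℝ) i + 1) := by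
    ext x
    rw [cell_eq, mem_preimage, ZSpan.mem_fundamentalDomain]
    simp [latticeBasis_repr]
  have h2 : {x : Fin 2 → ℝ | ∀ i, x i ∈ Ioc ((0 : Fin 2 → ℝ) i) ((0 : Fin 2 → ℝ) i + 1)}
      = univ.pi fun i => Ioc ((0 : Fin 2 → ℝ) i) ((0 : Fin 2 → ℝ) i + 1) := by
    ext x; simp
  rw [h1, h2]
  exact Measure.univ_pi_Ico_ae_eq_Icc.trans Measure.univ_pi_Ioc_ae_eq_Icc.symm

lemma measurable_latticeCoord_symm : Measurable latticeCoord.symm :=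
  latticeCoord.symm.toContinuousLinearEquiv.continuous.measurable

lemma exists_measurePreserving_torusToPlane :
    ∃ c : NNReal, c ≠ 0 ∧
      MeasurePreserving torusToPlane volume (c • (volume : Measure Plane).restrict cell) := by
  obtain ⟨c, hc, h⟩ := map_latticeCoord_symm
  refine ⟨c, hc, ?_⟩
  have hbox : MeasurableSet
      {x : Fin 2 → ℝ | ∀ i, x i ∈ Ioc ((0 : Fin 2 → ℝ) i) ((0 : Fin 2 → ℝ) i + 1)} :=
    MeasurableSet.univ_pi' fun i => measurableSet_Ioc
  have h1 := UnitAddTorus.measurePreserving_equivPiIoc (0 : Fin 2 → ℝ)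
  have h2 : MeasurePreserving (Subtype.val : {x : Fin 2 → ℝ // ∀ i, x i ∈
      Ioc ((0 : Fin 2 → ℝ) i) ((0 : Fin 2 → ℝ) i + 1)} → Fin 2 → ℝ) (Measure.comap Subtype.val volume)
      (volume.restrict {x : Fin 2 → ℝ | ∀ i, x i ∈
        Ioc ((0 : Fin 2 → ℝ) i) ((0 : Fin 2 → ℝ) i + 1)}) :=
    ⟨measurable_subtype_coe, map_comap_subtype_coe hbox volume⟩
  have h3 : MeasurePreserving latticeCoord.symm (volume.restrict {x : Fin 2 → ℝ | ∀ i, x i ∈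
        Ioc ((0 : Fin 2 → ℝ) i) ((0 : Fin 2 → ℝ) i + 1)})
        (c • (volume : Measure Plane).restrict cell) := by
    refine ⟨measurable_latticeCoord_symm, ?_⟩
    rw [← Measure.restrict_congr_set preimage_cell_ae_eq,
      ← Measure.restrict_map measurable_latticeCoord_symm measurableSet_cell, h,
      Measure.restrict_smul]
  exact h3.comp (h2.comp h1)

/-- A square integrable function on the cell all of whose Fourier coefficients vanish is zero. -/
lemma eq_zero_of_setIntegral_wave_eq_zero (f : Lp ℂ 2 ((volume : Measure Plane).restrict cell))
    (hf : ∀ k, ∫ x in cell, wave k x * f x = 0) : f = 0 := by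
  obtain ⟨c, hc, hT⟩ := exists_measurePreserving_torusToPlane
  have hfm : MemLp f 2 (c • (volume : Measure Plane).restrict cell) :=
    (Lp.memLp f).smul_measure ENNReal.coe_ne_top
  have hF : MemLp (f ∘ torusToPlane) 2 volume := hfm.comp_measurePreserving hT
  -- Pulled back to the standard torus, `f` has vanishing Fourier coefficients there, and
  -- completeness of the characters applies.
  have h0 : hF.toLp _ = 0 := by
    apply UnitAddTorus.mFourierBasis.repr.injective
    ext k
    rw [UnitAddTorus.mFourierBasis_repr, map_zero]
    have h1 : UnitAddTorus.mFourierCoeff (hF.toLp _) k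
        = ∫ z, (fun x => wave (-k) x * f x) (torusToPlane z) := by
      refine integral_congr_ae ?_
      filter_upwards [hF.coeFn_toLp] with z hz
      rw [hz, smul_eq_mul, mFourier_eq_wave]; rfl
    have h2 : AEStronglyMeasurable (fun x => wave (-k) x * f x)
        (Measure.map torusToPlane volume) := by
      rw [hT.map_eq]
      exact ((contDiff_wave _).continuous.aestronglyMeasurable.mul hfm.1)
    rw [h1, ← integral_map hT.measurable.aemeasurable h2, hT.map_eq, integral_smul_nnreal_measure,
      hf, smul_zero]
    rfl
  have h1 : ∀ᵐ z, f (torusToPlane z) = 0 := by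
    filter_upwards [hF.coeFn_toLp, (Lp.eq_zero_iff_ae_eq_zero).1 h0] with z h1 h2
    rw [← Function.comp_apply (f := f), ← h1, h2]; rfl
  have hS : MeasurableSet {x | f x = 0} :=
    measurableSet_eq_fun (Lp.stronglyMeasurable f).measurable measurable_const
  have h2 : ∀ᵐ x ∂(c • (volume : Measure Plane).restrict cell), f x = 0 := by
    rw [← hT.map_eq, ae_map_iff hT.measurable.aemeasurable hS]
    exact h1
  rw [Lp.eq_zero_iff_ae_eq_zero]
  exact (Measure.ae_smul_measure_iff (by simpa using hc)).1 h2

lemma setIntegral_wave (k : Fin 2 → ℤ) :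
    ∫ x in cell, wave k x = if k = 0 then (((volume : Measure Plane).real cell : ℝ) : ℂ) else 0 := by
  split_ifs with hk
  · subst hk
    simp [wave_zero]
  · obtain ⟨i, hi⟩ := Function.ne_iff.1 hk
    -- The shift by `r_i / (2 k_i)` changes the phase by `π`; translation invariance then equates
    -- the integral with its own negative.
    have hy : wave k ((1 / (2 * (k i : ℝ))) • latticeBasis i) = -1 := by
      have : latticeCoord (latticeBasis i) = Pi.single i 1 := by
        ext j
        rw [← latticeBasis_repr]
        simp [Finsupp.single_apply, Pi.single_apply, eq_comm]
      have hi' : (k i : ℂ) ≠ 0 := by exact_mod_cast hi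
      rw [wave_eq_latticeCoord, map_smul, this, ← Complex.exp_pi_mul_I]
      congr 1
      fin_cases i <;> simp at hi' ⊢ <;> field_simp
    have h := setIntegral_cell_add (latticePeriodic_wave k)
      ((1 / (2 * (k i : ℝ))) • latticeBasis i)
    simp only [wave_add, hy, mul_neg, mul_one, integral_neg] at h
    have h2 : (2 : ℂ) * ∫ x in cell, wave k x = 0 := by
      linear_combination -h
    simpa using h2

/-! ### The Fourier basis of `L²` of the cell -/

/-- The Hilbert space `L²` of the cell. -/
abbrev CellL2 : Type := Lp ℂ 2 ((volume : Measure Plane).restrict cell)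

/-- The area of the cell. -/
def cellArea : ℝ := (volume : Measure Plane).real cell

lemma cellArea_pos : 0 < cellArea :=
  ENNReal.toReal_pos volume_cell_ne_zero volume_cell_lt_top.ne

lemma memLp_wave (k : Fin 2 → ℤ) : MemLp (wave k) 2 ((volume : Measure Plane).restrict cell) :=
  MemLp.of_bound (contDiff_wave k).continuous.aestronglyMeasurable 1
    (Filter.Eventually.of_forall fun x => (norm_wave k x).le)

/-- The normalized plane wave as an element of `L²` of the cell. -/
def waveLp (k : Fin 2 → ℤ) : CellL2 :=
  (((√cellArea)⁻¹ : ℝ) : ℂ) • (memLp_wave k).toLp (wave k)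

lemma coeFn_waveLp (k : Fin 2 → ℤ) :
    waveLp k =ᵐ[(volume : Measure Plane).restrict cell]
      fun x => (((√cellArea)⁻¹ : ℝ) : ℂ) * wave k x := by
  filter_upwards [Lp.coeFn_smul (((√cellArea)⁻¹ : ℝ) : ℂ) ((memLp_wave k).toLp (wave k)),
    (memLp_wave k).coeFn_toLp] with x h1 h2
  rw [waveLp, h1, Pi.smul_apply, h2, smul_eq_mul]

lemma inner_waveLp (k : Fin 2 → ℤ) (f : CellL2) :
    inner ℂ (waveLp k) f = (((√cellArea)⁻¹ : ℝ) : ℂ) * ∫ x in cell, wave (-k) x * f x := by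
  rw [L2.inner_def, ← integral_const_mul]
  refine integral_congr_ae ?_
  filter_upwards [coeFn_waveLp k] with x hx
  rw [hx, RCLike.inner_apply, map_mul, Complex.conj_ofReal, conj_wave]
  ring

lemma orthonormal_waveLp : Orthonormal ℂ waveLp := by
  rw [orthonormal_iff_ite]
  intro k l
  rw [inner_waveLp]
  have h1 : ∫ x in cell, wave (-k) x * waveLp l x
      = (((√cellArea)⁻¹ : ℝ) : ℂ) * ∫ x in cell, wave (-k + l) x := by
    rw [← integral_const_mul]
    refine integral_congr_ae ?_
    filter_upwards [coeFn_waveLp l] with x hx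
    rw [hx, wave_index_add]; ring
  rw [h1, setIntegral_wave]
  have h2 : (-k + l = 0) ↔ k = l := by rw [neg_add_eq_zero]
  simp only [h2]
  split_ifs
  · have := cellArea_pos
    norm_cast
    change (√cellArea)⁻¹ * ((√cellArea)⁻¹ * cellArea) = 1
    rw [← mul_assoc, ← mul_inv, Real.mul_self_sqrt this.le, inv_mul_cancel₀ this.ne']
  · simp

/-- The orthonormal basis of normalized plane waves. -/
def waveBasis : HilbertBasis (Fin 2 → ℤ) ℂ CellL2 :=
  HilbertBasis.mkOfOrthogonalEqBot orthonormal_waveLp (by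
    rw [eq_bot_iff]
    intro f hf
    rw [Submodule.mem_bot]
    apply eq_zero_of_setIntegral_wave_eq_zero
    intro k
    have h := (Submodule.mem_orthogonal _ _).1 hf (waveLp (-k)) (Submodule.subset_span ⟨_, rfl⟩)
    rw [inner_waveLp, neg_neg] at h
    refine (mul_eq_zero.1 h).resolve_left ?_
    have := cellArea_pos
    simp only [ne_eq, Complex.ofReal_eq_zero]
    positivity)

lemma waveBasis_apply (k : Fin 2 → ℤ) : waveBasis k = waveLp k := by
  rw [waveBasis, HilbertBasis.coe_mkOfOrthogonalEqBot]

lemma waveBasis_repr (f : CellL2) (k : Fin 2 → ℤ) :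
    waveBasis.repr f k = (((√cellArea)⁻¹ : ℝ) : ℂ) * ∫ x in cell, wave (-k) x * f x := by
  rw [HilbertBasis.repr_apply_apply, waveBasis_apply, inner_waveLp]

/-! ### Diagonal operators in a Hilbert basis -/

section Diagonal

variable {ι H : Type*} [NormedAddCommGroup H] [InnerProductSpace ℂ H] (b : HilbertBasis ι ℂ H)

lemma hasSum_norm_repr_sq (f : H) : HasSum (fun i => ‖b.repr f i‖ ^ 2) (‖f‖ ^ 2) := by
  have h := (b.hasSum_inner_mul_inner f f).mapL Complex.reCLM
  have h2 : Complex.reCLM (inner ℂ f f) = ‖f‖ ^ 2 := by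
    rw [inner_self_eq_norm_sq_to_K]; norm_cast
  rw [h2] at h
  refine h.congr_fun fun i => ?_
  rw [b.repr_apply_apply, ← inner_conj_symm, RCLike.mul_conj, RCLike.norm_conj]
  norm_cast

lemma norm_le_of_norm_repr_le {B : ℝ} (hB : 0 ≤ B) {f g : H}
    (h : ∀ i, ‖b.repr g i‖ ≤ B * ‖b.repr f i‖) : ‖g‖ ≤ B * ‖f‖ := by
  have h1 := (hasSum_norm_repr_sq b g)
  have h2 := (hasSum_norm_repr_sq b f).mul_left (B ^ 2)
  have h3 : ‖g‖ ^ 2 ≤ (B * ‖f‖) ^ 2 := by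
    rw [mul_pow]
    refine hasSum_le (fun i => ?_) h1 h2
    rw [← mul_pow]
    exact pow_le_pow_left₀ (norm_nonneg _) (h i) 2
  exact le_of_sq_le_sq h3 (by positivity)

lemma exists_repr_eq {a : ι → ℂ} (ha : Summable fun i => ‖a i‖ ^ 2) :
    ∃ f : H, ∀ i, b.repr f i = a i := by
  have hm : Memℓp a 2 := memℓp_gen (by simpa using ha)
  exact ⟨b.repr.symm ⟨a, hm⟩, fun i => by simp⟩

lemma exists_diagonal {c : ι → ℝ} {B : ℝ} (hB : 0 ≤ B) (hc : ∀ i, |c i| ≤ B) :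
    ∃ G : H →L[ℂ] H, ∀ f i, b.repr (G f) i = c i * b.repr f i := by
  have hb : ∀ (f : H) i, ‖(c i : ℂ) * b.repr f i‖ ≤ B * ‖b.repr f i‖ := fun f i => by
    rw [norm_mul, Complex.norm_real]
    exact mul_le_mul_of_nonneg_right (hc i) (norm_nonneg _)
  have hs : ∀ f : H, Summable fun i => ‖(c i : ℂ) * b.repr f i‖ ^ 2 := fun f => by
    refine Summable.of_nonneg_of_le (fun i => by positivity) (fun i => ?_)
      ((hasSum_norm_repr_sq b f).summable.mul_left (B ^ 2))
    rw [← mul_pow]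
    exact pow_le_pow_left₀ (norm_nonneg _) (hb f i) 2
  choose G hG using fun f => exists_repr_eq b (hs f)
  let L : H →ₗ[ℂ] H :=
    { toFun := G
      map_add' := fun f g => b.repr.injective (by
        ext i; simp [hG, mul_add])
      map_smul' := fun a f => b.repr.injective (by
        ext i; simp [hG, mul_left_comm]) }
  refine ⟨L.mkContinuous B fun f => norm_le_of_norm_repr_le b hB fun i => ?_, hG⟩
  change ‖b.repr (G f) i‖ ≤ _
  rw [hG]; exact hb f i

lemma inner_diagonal {c : ι → ℝ} {G : H →L[ℂ] H}
    (hG : ∀ f i, b.repr (G f) i = c i * b.repr f i) (f g : H) :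
    inner ℂ (G f) g = inner ℂ f (G g) := by
  rw [← b.repr.inner_map_map (G f), ← b.repr.inner_map_map f, lp.inner_eq_tsum, lp.inner_eq_tsum]
  congr 1; ext i
  simp only [RCLike.inner_apply, hG, map_mul, Complex.conj_ofReal]
  ring

/-- The truncations to finitely many indices have finite rank and converge in operator norm, because
the multipliers outside a finite set are uniformly small. -/
lemma isCompactOperator_diagonal [CompleteSpace H] {c : ι → ℝ} {G : H →L[ℂ] H}
    (hG : ∀ f i, b.repr (G f) i = c i * b.repr f i)
    (hc : Filter.Tendsto c Filter.cofinite (nhds 0)) : IsCompactOperator G := by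
  classical
  let F : Finset ι → H →L[ℂ] H := fun s =>
    ∑ i ∈ s, (c i : ℂ) • (innerSL ℂ (b i)).smulRight (b i)
  have hF : ∀ s f i, b.repr (F s f) i = if i ∈ s then c i * b.repr f i else 0 := by
    intro s f i
    have : ∀ x ∈ s, ((c x : ℂ) * inner ℂ (b x) f) * (b.repr (b x) i)
        = if i = x then c i * b.repr f i else 0 := by
      intro x _
      rw [b.repr_self, lp.single_apply, b.repr_apply_apply]
      split_ifs with h
      · subst h; simp
      · simp [Pi.single_eq_of_ne h]
    simp only [F, sum_apply, smul_apply,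
      ContinuousLinearMap.smulRight_apply, innerSL_apply_apply, map_sum, map_smul]
    rw [lp.coeFn_sum, Finset.sum_apply]
    simp only [lp.coeFn_smul, Pi.smul_apply, smul_eq_mul, ← mul_assoc]
    rw [Finset.sum_congr rfl this, Finset.sum_ite_eq]
  have hT : Filter.Tendsto F Filter.atTop (nhds G) := by
    rw [Metric.tendsto_atTop]
    intro ε hε
    have h1 : {i | ¬ |c i| < ε / 2}.Finite := by
      have := (Metric.tendsto_nhds.1 hc) (ε / 2) (half_pos hε)
      simpa using this
    refine ⟨h1.toFinset, fun s hs => ?_⟩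
    rw [dist_eq_norm]
    refine lt_of_le_of_lt (ContinuousLinearMap.opNorm_le_bound _ (half_pos hε).le fun f => ?_)
      (half_lt_self hε)
    refine norm_le_of_norm_repr_le b (half_pos hε).le fun i => ?_
    rw [sub_apply, map_sub, lp.coeFn_sub, Pi.sub_apply, hF, hG]
    split_ifs with h
    · simp; positivity
    · have h2 : |c i| < ε / 2 := by
        by_contra h3
        exact h (hs (by simpa using h3))
      rw [zero_sub, norm_neg, norm_mul, Complex.norm_real]
      exact mul_le_mul_of_nonneg_right h2.le (norm_nonneg _)
  refine isCompactOperator_of_tendsto hT (Filter.Eventually.of_forall fun s => ?_)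
  have hsum : ∀ t : Finset ι, IsCompactOperator (F t) := by
    intro t
    induction t using Finset.induction_on with
    | empty => simpa [F] using isCompactOperator_zero
    | insert a t ha ih =>
      have : F (insert a t) = (c a : ℂ) • (innerSL ℂ (b a)).smulRight (b a) + F t := by
        simp [F, Finset.sum_insert ha]
      rw [this]
      have h1 : IsCompactOperator (innerSL ℂ (b a)) :=
        isCompactOperator_of_locallyCompactSpace_dom (innerSL ℂ (b a))
      have h2 : IsCompactOperator ((innerSL ℂ (b a)).smulRight (b a)) :=
        h1.clm_comp (ContinuousLinearMap.toSpanSingleton ℂ (b a))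
      exact (h2.smul (c a : ℂ)).add ih
  exact hsum s

end Diagonal

/-! ### A spectral gap -/

section Gap

variable {H : Type*} [NormedAddCommGroup H] [InnerProductSpace ℂ H]

/-- For self-adjoint `G` and `A` the adjoint of `1 + A G` is `1 + G A`, which kills `G h` when `h +
A G h = 0`. So `G h` is orthogonal to the range of `1 + A G`; this is the solvability condition that
later produces the amplitude equations. -/
lemma inner_add_comp_eq_zero {G A : H →L[ℂ] H} (hG : ∀ f g, inner ℂ (G f) g = inner ℂ f (G g))
    (hA : ∀ f g, inner ℂ (A f) g = inner ℂ f (A g)) {h : H} (hh : h + A (G h) = 0) (g : H) :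
    inner ℂ (G h) (g + A (G g)) = 0 := by
  rw [inner_add_right, hG, ← hA, ← inner_add_left, hh, inner_zero_left]

/-- If `G` is compact, and the kernel of `1 + A G` is mapped by `G` into the span of the orthonormal
pair `G ga`, `G gb`, then `1 + A G` is bounded below on the vectors that `G` maps into the
orthogonal complement of this pair. -/
lemma exists_gap [CompleteSpace H] {G A : H →L[ℂ] H}
    (hG : ∀ f g, inner ℂ (G f) g = inner ℂ f (G g))
    (hA : ∀ f g, inner ℂ (A f) g = inner ℂ f (A g)) (hcpt : IsCompactOperator G)
    (hinj : ∀ g, G g = 0 → g = 0) {ga gb : H} (ha : ga + A (G ga) = 0) (hb : gb + A (G gb) = 0)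
    (na : ‖G ga‖ = 1) (nb : ‖G gb‖ = 1) (hab : inner ℂ (G ga) (G gb) = 0)
    (hspan : ∀ g, g + A (G g) = 0 → ∃ α β : ℂ, G g = α • G ga + β • G gb) :
    ∃ c > 0, ∀ g, inner ℂ (G ga) (G g) = 0 → inner ℂ (G gb) (G g) = 0 →
      ‖g‖ ≤ c * ‖g + A (G g)‖ := by
  have hba : inner ℂ (G gb) (G ga) = 0 := by rw [← inner_conj_symm, hab, map_zero]
  have haa : inner ℂ (G ga) (G ga) = 1 := by rw [inner_self_eq_norm_sq_to_K, na]; simp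
  have hbb : inner ℂ (G gb) (G gb) = 1 := by rw [inner_self_eq_norm_sq_to_K, nb]; simp
  -- `Q` is the orthogonal projection to the ground eigenspace. Adding it makes `1 + (A + Q) G`
  -- injective and changes nothing on the vectors in question, where `Q (G g) = 0`.
  let Q : H →L[ℂ] H := (innerSL ℂ (G ga)).smulRight (G ga) + (innerSL ℂ (G gb)).smulRight (G gb)
  have hQ : ∀ x, Q x = inner ℂ (G ga) x • G ga + inner ℂ (G gb) x • G gb := fun x => by simp [Q]
  let T : H →L[ℂ] H := -((A + Q).comp G)
  have hT : ∀ g, (T - (1 : ℂ) • 1) g = -(g + A (G g) + Q (G g)) := fun g => by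
    simp [T]; abel
  have hTc : IsCompactOperator T := (hcpt.clm_comp (A + Q)).neg
  have hne : ¬ Module.End.HasEigenvalue (T : Module.End ℂ H) 1 := by
    intro hev
    obtain ⟨g, hg⟩ := hev.exists_hasEigenvector
    have h1 : T g = g := by simpa using hg.apply_eq_smul
    have h2 : g + A (G g) + Q (G g) = 0 := by
      have := hT g
      simp only [sub_apply, h1, one_smul, one_apply_eq_self,
        sub_self] at this
      rw [← neg_eq_zero, ← this]
    -- Pairing `g + A G g + Q G g = 0` with `G ga` removes the first two terms by the solvability
    -- condition and leaves the coefficient of `G g` along `G ga`.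
    have h3 : inner ℂ (G ga) (G g) = 0 := by
      have := congrArg (inner ℂ (G ga)) h2
      rw [inner_add_right, inner_add_comp_eq_zero hG hA ha, hQ] at this
      simpa [inner_add_right, inner_smul_right, haa, hab, na] using this
    have h4 : inner ℂ (G gb) (G g) = 0 := by
      have := congrArg (inner ℂ (G gb)) h2
      rw [inner_add_right, inner_add_comp_eq_zero hG hA hb, hQ] at this
      simpa [inner_add_right, inner_smul_right, hbb, hba, nb] using this
    have h5 : Q (G g) = 0 := by rw [hQ, h3, h4]; simp
    rw [h5, add_zero] at h2
    obtain ⟨α, β, h6⟩ := hspan g h2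
    have h7 : α = 0 := by
      rw [h6] at h3
      simpa [inner_add_right, inner_smul_right, haa, hab, na] using h3
    have h8 : β = 0 := by
      rw [h6] at h4
      simpa [inner_add_right, inner_smul_right, hbb, hba, nb] using h4
    exact hg.2 (hinj g (by rw [h6, h7, h8]; simp))
  -- Fredholm alternative: `1` is not an eigenvalue of the compact `T`, so `T - 1` is bounded below.
  -- The `+ 1` in the next line makes the constant positive.
  obtain ⟨K, hK⟩ := hTc.antilipschitz_of_not_hasEigenvalue one_ne_zero hne
  refine ⟨K + 1, by positivity, fun g h1 h2 => ?_⟩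
  have h3 := hK.le_mul_dist g 0
  rw [map_zero, dist_zero_right, dist_zero_right, hT, norm_neg, hQ, h1, h2] at h3
  simp only [zero_smul, add_zero] at h3
  nlinarith [norm_nonneg (g + A (G g))]

end Gap

/-! ### Weak derivatives and Fourier coefficients -/

lemma LatticePeriodic.exists_bound {E : Type} [NormedAddCommGroup E] {f : Plane → E}
    (hf : LatticePeriodic f) (hc : Continuous f) : ∃ C > 0, ∀ x, ‖f x‖ ≤ C := by
  obtain ⟨C, hC⟩ := isBounded_cell.isCompact_closure.exists_bound_of_continuousOn hc.continuousOn
  refine ⟨max C 1, by positivity, fun x => ?_⟩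
  rw [← hf.fract x]
  exact (hC _ (subset_closure (fract_mem_cell x))).trans (le_max_left _ _)

lemma LatticePeriodic.map {α β : Type} {f : Plane → α} (hf : LatticePeriodic f) (g : α → β) :
    LatticePeriodic fun x => g (f x) :=
  ⟨fun x => congrArg g (hf.1 x), fun x => congrArg g (hf.2 x)⟩

lemma LatticePeriodic.map₂ {α β γ : Type} {f : Plane → α} {g : Plane → β} (hf : LatticePeriodic f)
    (hg : LatticePeriodic g) (u : α → β → γ) : LatticePeriodic fun x => u (f x) (g x) :=
  ⟨fun x => congrArg₂ u (hf.1 x) (hg.1 x), fun x => congrArg₂ u (hf.2 x) (hg.2 x)⟩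

lemma LatticePeriodic.fderiv {F : Plane → ℂ} (hF : LatticePeriodic F) :
    LatticePeriodic (fderiv ℝ F) := by
  constructor <;> intro x <;> rw [← fderiv_comp_add_right] <;> congr 1 <;> ext y
  · exact hF.1 y
  · exact hF.2 y

/-- The integral over the cell of a derivative of a smooth periodic function vanishes. -/
lemma setIntegral_fderiv_eq_zero {F : Plane → ℂ} (hF : ContDiff ℝ ∞ F) (hp : LatticePeriodic F)
    (v : Plane) : ∫ x in cell, fderiv ℝ F x v = 0 := by
  have hd : Continuous (fderiv ℝ F) := hF.continuous_fderiv (by simp)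
  obtain ⟨C, hC0, hC⟩ := hp.fderiv.exists_bound hd
  obtain ⟨C', -, hC'⟩ := hp.exists_bound hF.continuous
  have hpv : LatticePeriodic fun x => fderiv ℝ F x v :=
    hp.fderiv.map fun L => L v
  have hint : ∀ y, Integrable (fun x => F (x + y)) ((volume : Measure Plane).restrict cell) :=
    fun y => Integrable.of_bound (by
      have := hF.continuous
      exact (by fun_prop : Continuous fun x => F (x + y)).aestronglyMeasurable) C'
      (Filter.Eventually.of_forall fun x => hC' _)
  have h1 : ∀ x, ∫ t in (0 : ℝ)..1, fderiv ℝ F (x + t • v) v = F (x + v) - F x := by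
    intro x
    have h : ∀ t : ℝ, HasDerivAt (fun t : ℝ => F (x + t • v)) (fderiv ℝ F (x + t • v) v) t := by
      intro t
      have h2 : HasFDerivAt F (fderiv ℝ F (x + t • v)) (x + t • v) :=
        (hF.differentiable (by simp) _).hasFDerivAt
      have h3 : HasDerivAt (fun t : ℝ => x + t • v) v t := by
        simpa using ((hasDerivAt_id t).smul_const v).const_add x
      exact h2.comp_hasDerivAt t h3
    rw [intervalIntegral.integral_eq_sub_of_hasDerivAt (fun t _ => h t)]
    · simp
    · exact (by fun_prop : Continuous fun t : ℝ => fderiv ℝ F (x + t • v) v).intervalIntegrable _ _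
  have h2 : ∀ t : ℝ, ∫ x in cell, fderiv ℝ F (x + t • v) v = ∫ x in cell, fderiv ℝ F x v :=
    fun t => setIntegral_cell_add hpv (t • v)
  -- The cell integral of the derivative at `x + t v` does not depend on `t`. Averaging over `t ∈
  -- [0,1]` and exchanging the integrals turns it into the integral of `F(x + v) - F(x)`, which
  -- vanishes by periodicity.
  have h3 : ∫ t in (0 : ℝ)..1, ∫ x in cell, fderiv ℝ F (x + t • v) v
      = ∫ x in cell, ∫ t in (0 : ℝ)..1, fderiv ℝ F (x + t • v) v := by
    simp only [intervalIntegral.integral_of_le zero_le_one]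
    refine integral_integral_swap ?_
    refine Integrable.of_bound
      (by exact (by fun_prop : Continuous fun p : ℝ × Plane =>
        fderiv ℝ F (p.2 + p.1 • v) v).aestronglyMeasurable) (C * ‖v‖)
      (Filter.Eventually.of_forall fun p => ?_)
    exact (ContinuousLinearMap.le_opNorm _ _).trans
      (mul_le_mul_of_nonneg_right (hC _) (norm_nonneg _))
  simp only [h2, h1] at h3
  rw [integral_sub (hint v) (by simpa using hint 0), setIntegral_cell_add hp v, sub_self] at h3
  simpa using h3

/-- The element of `L²` of the cell defined by a periodic function. -/
def MemL2.lp {f : Plane → ℂ} (hf : MemL2 f) : CellL2 := hf.2.toLp f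

lemma MemL2.coeFn_lp {f : Plane → ℂ} (hf : MemL2 f) :
    hf.lp =ᵐ[(volume : Measure Plane).restrict cell] f := hf.2.coeFn_toLp

lemma memL2_of_smooth {η : Plane → ℂ} (h : ContDiff ℝ ∞ η) (hp : LatticePeriodic η) : MemL2 η := by
  obtain ⟨C, -, hC⟩ := hp.exists_bound h.continuous
  exact ⟨hp, MemLp.of_bound h.continuous.aestronglyMeasurable C (Filter.Eventually.of_forall hC)⟩

lemma memL2_fderiv {η : Plane → ℂ} (h : ContDiff ℝ ∞ η) (hp : LatticePeriodic η) (v : Plane) :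
    MemL2 fun x => fderiv ℝ η x v := by
  refine memL2_of_smooth ?_ (hp.fderiv.map fun L => L v)
  have h1 : ContDiff ℝ ∞ (fderiv ℝ η) := h.fderiv_right (by simp)
  exact h1.clm_apply contDiff_const

/-- The Fourier coefficients of a function on the cell. -/
def coef (f : Plane → ℂ) (k : Fin 2 → ℤ) : ℂ := ∫ x in cell, wave (-k) x * f x

lemma MemL2.repr_lp {f : Plane → ℂ} (hf : MemL2 f) (k : Fin 2 → ℤ) :
    waveBasis.repr hf.lp k = (((√cellArea)⁻¹ : ℝ) : ℂ) * coef f k := by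
  rw [waveBasis_repr, coef]
  congr 1
  refine integral_congr_ae ?_
  filter_upwards [hf.coeFn_lp] with x hx
  rw [hx]

lemma inv_sqrt_cellArea_ne_zero : (((√cellArea)⁻¹ : ℝ) : ℂ) ≠ 0 := by
  have := cellArea_pos
  simp only [ne_eq, Complex.ofReal_eq_zero]
  positivity

lemma coef_weakPartial {i : Fin 2} {f g : Plane → ℂ} (h : IsWeakPartial i f g) (k : Fin 2 → ℤ) :
    coef g k = Complex.I * (waveVector k i : ℂ) * coef f k := by
  have h1 := h.2 (wave (-k)) (contDiff_wave _) (latticePeriodic_wave _)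
  simp only [fderiv_wave, waveVector_neg, PiLp.neg_apply, Complex.ofReal_neg] at h1
  have h2 : ∫ x in cell, f x * (Complex.I * -(waveVector k i : ℂ) * wave (-k) x)
      = -(Complex.I * (waveVector k i : ℂ)) * coef f k := by
    rw [coef, ← integral_const_mul]
    congr 1; ext x; ring
  have h3 : ∫ x in cell, g x * wave (-k) x = coef g k := by
    simp only [coef, mul_comm]
  rw [h2, h3] at h1
  linear_combination h1

lemma coef_fderiv {η : Plane → ℂ} (h : ContDiff ℝ ∞ η) (hp : LatticePeriodic η) (i : Fin 2)
    (k : Fin 2 → ℤ) : coef (fun x => fderiv ℝ η x (EuclideanSpace.single i 1)) k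
      = Complex.I * (waveVector k i : ℂ) * coef η k := by
  have h1 := setIntegral_fderiv_eq_zero ((contDiff_wave (-k)).mul h)
    ((latticePeriodic_wave (-k)).map₂ hp (· * ·)) (EuclideanSpace.single i 1)
  have h2 : ∀ x, fderiv ℝ (fun x => wave (-k) x * η x) x (EuclideanSpace.single i 1)
      = wave (-k) x * fderiv ℝ η x (EuclideanSpace.single i 1)
        - Complex.I * (waveVector k i : ℂ) * (wave (-k) x * η x) := by
    intro x
    rw [fderiv_fun_mul ((contDiff_wave (-k)).differentiable (by simp) x)
      (h.differentiable (by simp) x)]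
    simp only [add_apply, smul_apply, fderiv_wave, waveVector_neg, PiLp.neg_apply,
      Complex.ofReal_neg, smul_eq_mul]
    ring
  simp only [h2] at h1
  rw [integral_sub, integral_const_mul, sub_eq_zero] at h1
  · exact h1
  · exact (memLp_wave (-k)).integrable_mul (memL2_fderiv h hp _).2
  · exact ((memLp_wave (-k)).integrable_mul (memL2_of_smooth h hp).2).const_mul _

/-- By Parseval both sides of the weak identity are sums over Fourier coefficients, and the two
series agree term by term up to sign. The conjugate `ψ` of the test function appears because the
inner product is conjugate-linear on the left. -/
lemma isWeakPartial_of_coef {i : Fin 2} {f g : Plane → ℂ} (hf : MemL2 f) (hg : MemL2 g)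
    (h : ∀ k, coef g k = Complex.I * (waveVector k i : ℂ) * coef f k) : IsWeakPartial i f g := by
  refine ⟨hg, fun η hη hp => ?_⟩
  set ψ : Plane → ℂ := fun x => conj (η x) with hψ
  have hψs : ContDiff ℝ ∞ ψ := Complex.conjCLE.contDiff.comp hη
  have hψp : LatticePeriodic ψ := hp.map _
  have hd : ∀ x v, fderiv ℝ ψ x v = conj (fderiv ℝ η x v) := by
    intro x v
    have h1 : HasFDerivAt ψ _ x := Complex.conjCLE.hasFDerivAt.comp x
      (hη.differentiable (by simp) x).hasFDerivAt
    rw [h1.fderiv]; simp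
  have hψ2 := memL2_of_smooth hψs hψp
  have hdψ := memL2_fderiv hψs hψp (EuclideanSpace.single i 1)
  have h1 : ∫ x in cell, f x * fderiv ℝ η x (EuclideanSpace.single i 1)
      = inner ℂ hdψ.lp hf.lp := by
    rw [L2.inner_def]
    refine integral_congr_ae ?_
    filter_upwards [hdψ.coeFn_lp, hf.coeFn_lp] with x h1 h2
    rw [h1, h2, RCLike.inner_apply, hd]
    simp
  have h2 : ∫ x in cell, g x * η x = inner ℂ hψ2.lp hg.lp := by
    rw [L2.inner_def]
    refine integral_congr_ae ?_
    filter_upwards [hψ2.coeFn_lp, hg.coeFn_lp] with x h1 h2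
    rw [h1, h2, RCLike.inner_apply]
    simp [hψ]
  rw [h1, h2, ← waveBasis.repr.inner_map_map hdψ.lp, ← waveBasis.repr.inner_map_map hψ2.lp,
    lp.inner_eq_tsum, lp.inner_eq_tsum, ← tsum_neg]
  congr 1; ext k
  simp only [RCLike.inner_apply, MemL2.repr_lp, coef_fderiv hψs hψp, h, map_mul, Complex.conj_I,
    Complex.conj_ofReal]
  ring

/-- Every element of `L²` of the cell is represented by a periodic function. -/
lemma exists_memL2_lp_eq (g : CellL2) : ∃ (f : Plane → ℂ) (hf : MemL2 f), hf.lp = g := by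
  have h : (fun x => g (ZSpan.fract latticeBasis x)) =ᵐ[(volume : Measure Plane).restrict cell] g := by
    rw [Filter.EventuallyEq, ae_restrict_iff' measurableSet_cell]
    exact Filter.Eventually.of_forall fun x hx => by rw [fract_of_mem_cell hx]
  have hf : MemL2 fun x => g (ZSpan.fract latticeBasis x) :=
    ⟨latticePeriodic_comp_fract g, (memLp_congr_ae h).2 (Lp.memLp g)⟩
  exact ⟨_, hf, Lp.ext (hf.coeFn_lp.trans h)⟩

/-- Riesz–Fischer turns the square summable sequence of differentiated coefficients into a function,
which is then the weak derivative. -/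
lemma exists_isWeakPartial {f : Plane → ℂ} (hf : MemL2 f) (i : Fin 2)
    (h : Summable fun k => ‖(waveVector k i : ℂ) * waveBasis.repr hf.lp k‖ ^ 2) :
    ∃ g, IsWeakPartial i f g := by
  have h' : Summable fun k => ‖Complex.I * (waveVector k i : ℂ) * waveBasis.repr hf.lp k‖ ^ 2 := by
    simpa [mul_assoc] using h
  obtain ⟨g, hg⟩ := exists_repr_eq waveBasis h'
  obtain ⟨u, hu, rfl⟩ := exists_memL2_lp_eq g
  refine ⟨u, isWeakPartial_of_coef hf hu fun k => ?_⟩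
  have := hg k
  rw [hu.repr_lp, hf.repr_lp] at this
  refine mul_left_cancel₀ inv_sqrt_cellArea_ne_zero ?_
  rw [this]; ring

lemma isWeakPartial_weakPartial {i : Fin 2} {f : Plane → ℂ} (h : ∃ g, IsWeakPartial i f g) :
    IsWeakPartial i f (weakPartial i f) := by
  rw [weakPartial, dif_pos h]
  exact h.choose_spec

lemma MemH2.weakPartial_first {f : Plane → ℂ} (hf : MemH2 f) (i : Fin 2) :
    IsWeakPartial i f (weakPartial i f) := isWeakPartial_weakPartial (hf.first i)

lemma MemH2.weakPartial_second {f : Plane → ℂ} (hf : MemH2 f) (i j : Fin 2) :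
    IsWeakPartial j (weakPartial i f) (weakPartial j (weakPartial i f)) :=
  isWeakPartial_weakPartial (hf.second i j)

/-- The symbol `|k + K|²` of `-Δ_K`. -/
def symbol (k : Fin 2 → ℤ) : ℝ := (waveVector k 0 + Kpt 0) ^ 2 + (waveVector k 1 + Kpt 1) ^ 2

lemma symbol_nonneg (k : Fin 2 → ℤ) : 0 ≤ symbol k := by unfold symbol; positivity

lemma MemL2.add {f g : Plane → ℂ} (hf : MemL2 f) (hg : MemL2 g) : MemL2 (f + g) :=
  ⟨hf.1.map₂ hg.1 (· + ·), hf.2.add hg.2⟩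

lemma MemL2.sub {f g : Plane → ℂ} (hf : MemL2 f) (hg : MemL2 g) : MemL2 (f - g) :=
  ⟨hf.1.map₂ hg.1 (· - ·), hf.2.sub hg.2⟩

lemma MemL2.const_smul {f : Plane → ℂ} (hf : MemL2 f) (c : ℂ) : MemL2 (c • f) :=
  ⟨hf.1.map (c * ·), hf.2.const_smul c⟩

lemma coef_add {f g : Plane → ℂ} (hf : MemL2 f) (hg : MemL2 g) (k : Fin 2 → ℤ) :
    coef (f + g) k = coef f k + coef g k := by
  have h1 : Integrable (fun x => wave (-k) x * f x) ((volume : Measure Plane).restrict cell) :=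
    (memLp_wave _).integrable_mul hf.2
  have h2 : Integrable (fun x => wave (-k) x * g x) ((volume : Measure Plane).restrict cell) :=
    (memLp_wave _).integrable_mul hg.2
  rw [coef, coef, coef, ← integral_add h1 h2]
  simp [mul_add]

lemma coef_const_smul (c : ℂ) (f : Plane → ℂ) (k : Fin 2 → ℤ) :
    coef (c • f) k = c * coef f k := by
  rw [coef, coef, ← integral_const_mul]
  congr 1; ext x; simp; ring

lemma laplaceK_eq (f : Plane → ℂ) : laplaceK f =
    (weakPartial 0 (weakPartial 0 f) + (2 * Complex.I * (Kpt 0 : ℂ)) • weakPartial 0 f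
      + (-(Kpt 0 : ℂ) ^ 2) • f) +
    (weakPartial 1 (weakPartial 1 f) + (2 * Complex.I * (Kpt 1 : ℂ)) • weakPartial 1 f
      + (-(Kpt 1 : ℂ) ^ 2) • f) := by
  ext x
  simp [laplaceK, Fin.sum_univ_two]
  ring

lemma MemH2.memL2_laplaceK {f : Plane → ℂ} (hf : MemH2 f) : MemL2 (laplaceK f) := by
  rw [laplaceK_eq]
  exact (((hf.weakPartial_second 0 0).1.add ((hf.weakPartial_first 0).1.const_smul _)).add
    (hf.memL2.const_smul _)).add (((hf.weakPartial_second 1 1).1.add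
    ((hf.weakPartial_first 1).1.const_smul _)).add (hf.memL2.const_smul _))

lemma MemH2.coef_laplaceK {f : Plane → ℂ} (hf : MemH2 f) (k : Fin 2 → ℤ) :
    coef (laplaceK f) k = -(symbol k : ℂ) * coef f k := by
  have h0 := hf.weakPartial_first 0
  have h1 := hf.weakPartial_first 1
  have h00 := hf.weakPartial_second 0 0
  have h11 := hf.weakPartial_second 1 1
  have hI := Complex.I_sq
  rw [laplaceK_eq, coef_add, coef_add, coef_add, coef_add, coef_add, coef_const_smul,
    coef_const_smul, coef_const_smul, coef_const_smul, coef_weakPartial h00, coef_weakPartial h11,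
    coef_weakPartial h0, coef_weakPartial h1, symbol]
  · push_cast
    linear_combination ((waveVector k 0 : ℂ) ^ 2 + 2 * (waveVector k 0 : ℂ) * (Kpt 0 : ℂ)
      + (waveVector k 1 : ℂ) ^ 2 + 2 * (waveVector k 1 : ℂ) * (Kpt 1 : ℂ)) * coef f k * hI
  · exact h11.1
  · exact h1.1.const_smul _
  · exact h11.1.add (h1.1.const_smul _)
  · exact hf.memL2.const_smul _
  · exact h00.1
  · exact h0.1.const_smul _
  · exact h00.1.add (h0.1.const_smul _)
  · exact hf.memL2.const_smul _
  · exact (h00.1.add (h0.1.const_smul _)).add (hf.memL2.const_smul _)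
  · exact (h11.1.add (h1.1.const_smul _)).add (hf.memL2.const_smul _)

/-! ### The free resolvent `(1 - Δ_K)⁻¹` -/

lemma one_add_symbol_ge (k : Fin 2 → ℤ) :
    5 / 9 + 2 / 3 * ((k 0 : ℝ) ^ 2 + (k 1 : ℝ) ^ 2) ≤ 1 + symbol k := by
  have hpi : 1 ≤ Real.pi := by linarith [Real.pi_gt_three]
  have h3 : √3 ^ 2 = 3 := by simp
  have hpi2 : (1 : ℝ) ≤ 4 * Real.pi ^ 2 := by nlinarith
  have h1 : symbol k = 4 * Real.pi ^ 2 * (((k 0 : ℝ) + k 1) ^ 2 / 3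
      + ((k 0 : ℝ) - k 1 + 2 / 3) ^ 2) := by
    simp only [symbol, waveVector, Kpt, PiLp.toLp_apply, Matrix.cons_val_zero, Matrix.cons_val_one,
      Matrix.cons_val_fin_one, add_zero, div_pow, h3]
    ring
  have h2 : ((k 0 : ℝ) + k 1) ^ 2 / 3 + ((k 0 : ℝ) - k 1 + 2 / 3) ^ 2 ≤ symbol k := by
    rw [h1]
    exact le_mul_of_one_le_left (by positivity) hpi2
  -- With `d = k 0 - k 1`, `(d + 2/3)² ≥ d²/2 - 4/9`; then `1/2` is lowered to `1/3` and the two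
  -- squares combine, so that `5/9 = 1 - 4/9`.
  nlinarith [sq_nonneg ((k 0 : ℝ) - k 1 + 4 / 3), sq_nonneg ((k 0 : ℝ) - k 1)]

lemma one_add_symbol_pos (k : Fin 2 → ℤ) : 0 < 1 + symbol k := by
  linarith [symbol_nonneg k]

/-- The Fourier multiplier of the free resolvent. -/
def resolventSymbol (k : Fin 2 → ℤ) : ℝ := (1 + symbol k)⁻¹

lemma resolventSymbol_pos (k : Fin 2 → ℤ) : 0 < resolventSymbol k :=
  inv_pos.2 (one_add_symbol_pos k)

/-- The symbol grows quadratically, so the series compares with the sum of `‖k‖⁻⁴`, which converges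
on a lattice of rank 2. This gives both the compactness of the resolvent and the embedding of `H²`
into bounded functions. -/
lemma summable_resolventSymbol_sq : Summable fun k => resolventSymbol k ^ 2 := by
  -- The factor `9/4 = (3/2)²` comes from `1 + symbol k ≥ (2/3) ‖k‖²`.
  have h := (EisensteinSeries.summable_one_div_norm_rpow (k := 4) (by norm_num)).mul_left (9 / 4)
  refine Summable.of_norm_bounded_eventually h ?_
  have h0 : ∀ᶠ k : Fin 2 → ℤ in Filter.cofinite, k ≠ 0 := by
    simp
  filter_upwards [h0] with k hk
  have hn : 0 < ‖k‖ := norm_pos_iff.2 hk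
  have h1 : ‖k‖ ^ 2 ≤ (k 0 : ℝ) ^ 2 + (k 1 : ℝ) ^ 2 := by
    have : ‖k‖ ≤ √((k 0 : ℝ) ^ 2 + (k 1 : ℝ) ^ 2) := by
      refine (pi_norm_le_iff_of_nonneg (Real.sqrt_nonneg _)).2 fun i => ?_
      rw [Int.norm_eq_abs]
      refine Real.abs_le_sqrt ?_
      fin_cases i
      · simp only [Fin.zero_eta]; nlinarith [sq_nonneg (k 1 : ℝ)]
      · simp only [Fin.mk_one]; nlinarith [sq_nonneg (k 0 : ℝ)]
    calc ‖k‖ ^ 2 ≤ √((k 0 : ℝ) ^ 2 + (k 1 : ℝ) ^ 2) ^ 2 := by gcongr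
      _ = _ := Real.sq_sqrt (by positivity)
  have h2 : 2 / 3 * ‖k‖ ^ 2 ≤ 1 + symbol k := by
    linarith [one_add_symbol_ge k]
  have h3 : resolventSymbol k ≤ 3 / 2 * (‖k‖ ^ 2)⁻¹ := by
    rw [resolventSymbol]
    calc (1 + symbol k)⁻¹ ≤ (2 / 3 * ‖k‖ ^ 2)⁻¹ := by gcongr
      _ = _ := by rw [mul_inv]; norm_num
  rw [Real.norm_of_nonneg (by positivity), Real.rpow_neg hn.le]
  calc resolventSymbol k ^ 2 ≤ (3 / 2 * (‖k‖ ^ 2)⁻¹) ^ 2 := by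
        have := (resolventSymbol_pos k).le
        gcongr
    _ = 9 / 4 * (‖k‖ ^ (4 : ℝ))⁻¹ := by
        rw [show (4 : ℝ) = ((4 : ℕ) : ℝ) by norm_num, Real.rpow_natCast]
        ring

lemma tendsto_resolventSymbol : Filter.Tendsto resolventSymbol Filter.cofinite (nhds 0) := by
  have h := summable_resolventSymbol_sq.tendsto_cofinite_zero.sqrt
  simpa [Real.sqrt_sq (resolventSymbol_pos _).le] using h

lemma resolventSymbol_le_one (k : Fin 2 → ℤ) : |resolventSymbol k| ≤ 1 := by
  rw [abs_of_pos (resolventSymbol_pos k), resolventSymbol]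
  exact inv_le_one_of_one_le₀ (by linarith [symbol_nonneg k])

/-- The free resolvent `(1 - Δ_K)⁻¹`. -/
def freeResolvent : CellL2 →L[ℂ] CellL2 :=
  (exists_diagonal waveBasis zero_le_one resolventSymbol_le_one).choose

lemma repr_freeResolvent (g : CellL2) (k : Fin 2 → ℤ) :
    waveBasis.repr (freeResolvent g) k = resolventSymbol k * waveBasis.repr g k :=
  (exists_diagonal waveBasis zero_le_one resolventSymbol_le_one).choose_spec g k

lemma isCompactOperator_freeResolvent : IsCompactOperator freeResolvent :=
  isCompactOperator_diagonal waveBasis repr_freeResolvent tendsto_resolventSymbol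

lemma inner_freeResolvent (f g : CellL2) :
    inner ℂ (freeResolvent f) g = inner ℂ f (freeResolvent g) :=
  inner_diagonal waveBasis repr_freeResolvent f g

lemma freeResolvent_injective {g : CellL2} (h : freeResolvent g = 0) : g = 0 := by
  apply waveBasis.repr.injective
  ext k
  have h1 := repr_freeResolvent g k
  rw [h, map_zero, lp.coeFn_zero, Pi.zero_apply] at h1
  have h2 : (resolventSymbol k : ℂ) ≠ 0 := by exact_mod_cast (resolventSymbol_pos k).ne'
  simpa [h2] using h1.symm

lemma norm_freeResolvent_le (g : CellL2) : ‖freeResolvent g‖ ≤ ‖g‖ := by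
  have := norm_le_of_norm_repr_le waveBasis zero_le_one (f := g) (g := freeResolvent g) fun k => by
    rw [repr_freeResolvent, norm_mul, Complex.norm_real]
    exact mul_le_mul_of_nonneg_right (resolventSymbol_le_one k) (norm_nonneg _)
  simpa using this

/-- The element `(1 - Δ_K) f` of `L²` of the cell. -/
def MemH2.source {f : Plane → ℂ} (hf : MemH2 f) : CellL2 :=
  hf.memL2.lp - hf.memL2_laplaceK.lp

/-- Together with `exists_memH2_source_eq` this identifies `H²` with the range of the free
resolvent, so that equations in `H²` become equations for a bounded operator on `L²`. -/
lemma MemH2.freeResolvent_source {f : Plane → ℂ} (hf : MemH2 f) :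
    freeResolvent hf.source = hf.memL2.lp := by
  apply waveBasis.repr.injective
  ext k
  have h : (1 + symbol k : ℂ) ≠ 0 := by exact_mod_cast (one_add_symbol_pos k).ne'
  rw [repr_freeResolvent, MemH2.source, map_sub, lp.coeFn_sub, Pi.sub_apply, MemL2.repr_lp,
    MemL2.repr_lp, hf.coef_laplaceK, resolventSymbol]
  push_cast
  field_simp
  ring

/-- From `|k|² ≤ 2|k + K|² + 2|K|²`. It shows that `(1 - Δ_K)⁻¹` gains two derivatives. -/
lemma exists_waveVector_bound : ∃ B : ℝ, 0 ≤ B ∧ ∀ k : Fin 2 → ℤ, ∀ i j,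
    |waveVector k i| ≤ B * (1 + symbol k) ∧
    |waveVector k i * waveVector k j| ≤ B * (1 + symbol k) := by
  refine ⟨2 + 2 * (Kpt 0 ^ 2 + Kpt 1 ^ 2), by positivity, fun k i j => ?_⟩
  have h1 : ∀ i, waveVector k i ^ 2 ≤ 2 * symbol k + 2 * (Kpt 0 ^ 2 + Kpt 1 ^ 2) := by
    intro i
    fin_cases i
    · simp only [symbol, Fin.zero_eta]
      nlinarith [sq_nonneg (waveVector k 0 + 2 * Kpt 0), sq_nonneg (waveVector k 1 + Kpt 1),
        sq_nonneg (Kpt 1)]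
    · simp only [symbol, Fin.mk_one]
      nlinarith [sq_nonneg (waveVector k 1 + 2 * Kpt 1), sq_nonneg (waveVector k 0 + Kpt 0),
        sq_nonneg (Kpt 0)]
  have hs := symbol_nonneg k
  have hK : 0 ≤ (Kpt 0 ^ 2 + Kpt 1 ^ 2) * symbol k := by positivity
  constructor
  · have := h1 i
    rw [← sq_abs] at this
    nlinarith [sq_nonneg (|waveVector k i| - 1), sq_nonneg |waveVector k i|, sq_nonneg (Kpt 0),
      sq_nonneg (Kpt 1)]
  · have hi := h1 i
    have hj := h1 j
    rw [← sq_abs] at hi hj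
    rw [abs_mul]
    nlinarith [sq_nonneg (|waveVector k i| - |waveVector k j|)]

/-- Every element of the range of the free resolvent is represented by a function in `H²`. -/
lemma exists_memH2_source_eq (g : CellL2) : ∃ (f : Plane → ℂ) (hf : MemH2 f), hf.source = g := by
  obtain ⟨B, hB0, hB⟩ := exists_waveVector_bound
  obtain ⟨f, hf, hfg⟩ := exists_memL2_lp_eq (freeResolvent g)
  have hs : Summable fun k => (B * ‖waveBasis.repr g k‖) ^ 2 := by
    simp only [mul_pow]
    exact (hasSum_norm_repr_sq waveBasis g).summable.mul_left _
  have hbound : ∀ (k : Fin 2 → ℤ) (t : ℝ), |t| ≤ B * (1 + symbol k) →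
      ‖(t : ℂ) * waveBasis.repr hf.lp k‖ ≤ B * ‖waveBasis.repr g k‖ := by
    intro k t ht
    have h0 := one_add_symbol_pos k
    rw [hfg, repr_freeResolvent, norm_mul, norm_mul, Complex.norm_real, Complex.norm_real,
      Real.norm_eq_abs, Real.norm_eq_abs, abs_of_pos (resolventSymbol_pos k), ← mul_assoc,
      resolventSymbol]
    refine mul_le_mul_of_nonneg_right ?_ (norm_nonneg _)
    rwa [← div_eq_mul_inv, div_le_iff₀ h0]
  have hfirst : ∀ i, ∃ g, IsWeakPartial i f g := fun i =>
    exists_isWeakPartial hf i (Summable.of_nonneg_of_le (fun k => by positivity)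
      (fun k => pow_le_pow_left₀ (norm_nonneg _) (hbound k _ (hB k i i).1) 2) hs)
  have hf2 : MemH2 f := by
    refine ⟨hf, hfirst, fun i j => ?_⟩
    have h1 := isWeakPartial_weakPartial (hfirst i)
    refine exists_isWeakPartial h1.1 j (Summable.of_nonneg_of_le (fun k => by positivity)
      (fun k => pow_le_pow_left₀ (norm_nonneg _) ?_ 2) hs)
    refine le_trans (le_of_eq ?_) (hbound k _ (hB k j i).2)
    rw [h1.1.repr_lp, coef_weakPartial h1, hf.repr_lp]
    simp only [norm_mul, Complex.norm_I, Complex.norm_real, Real.norm_eq_abs]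
    ring
  refine ⟨f, hf2, ?_⟩
  have h := hf2.freeResolvent_source
  rw [← sub_eq_zero]
  apply freeResolvent_injective
  rw [map_sub, h, sub_eq_zero, ← hfg]

/-- Sobolev embedding: the free resolvent maps square integrable functions to bounded functions. -/
lemma exists_sobolev_bound : ∃ S > 0, ∀ g : CellL2,
    ∀ᵐ x ∂(volume : Measure Plane).restrict cell, ‖freeResolvent g x‖ ≤ S * ‖g‖ := by
  have hA := cellArea_pos
  set R : ℝ := √(∑' k, resolventSymbol k ^ 2) with hR
  -- The `+ 1` gives a positive constant without a proof that `R > 0`.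
  refine ⟨(√cellArea)⁻¹ * R + 1, by positivity, fun g => ?_⟩
  have hsum := waveBasis.hasSum_repr (freeResolvent g)
  -- A subsequence of the partial Fourier sums converges almost everywhere, so a bound uniform in
  -- the partial sums passes to the limit. That bound is Cauchy–Schwarz between the multipliers and
  -- the coefficients of `g`.
  obtain ⟨ns, -, hns⟩ := (tendstoInMeasure_of_tendsto_Lp (p := 2) hsum).exists_seq_tendsto_ae'
  have hpart : ∀ s : Finset (Fin 2 → ℤ), ∀ᵐ x ∂(volume : Measure Plane).restrict cell,
      ‖(∑ k ∈ s, waveBasis.repr (freeResolvent g) k • waveBasis k : CellL2) x‖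
        ≤ ((√cellArea)⁻¹ * R) * ‖g‖ := by
    intro s
    have h1 : ∀ᵐ x ∂(volume : Measure Plane).restrict cell, ∀ k,
        waveLp k x = (((√cellArea)⁻¹ : ℝ) : ℂ) * wave k x :=
      ae_all_iff.2 fun k => coeFn_waveLp k
    have h2 : ∀ᵐ x ∂(volume : Measure Plane).restrict cell, ∀ k,
        (waveBasis.repr (freeResolvent g) k • waveBasis k : CellL2) x
          = waveBasis.repr (freeResolvent g) k * waveLp k x := ae_all_iff.2 fun k => by
      filter_upwards [Lp.coeFn_smul (waveBasis.repr (freeResolvent g) k) (waveBasis k)] with x hx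
      rw [hx, Pi.smul_apply, waveBasis_apply, smul_eq_mul]
    filter_upwards [h1, h2, Lp.coeFn_finsetSum s
      (fun k => waveBasis.repr (freeResolvent g) k • waveBasis k)] with x h1 h2 h3
    rw [h3, Finset.sum_apply]
    refine (norm_sum_le _ _).trans ?_
    have h4 : ∀ k ∈ s, ‖(waveBasis.repr (freeResolvent g) k • waveBasis k : CellL2) x‖
        = (√cellArea)⁻¹ * (resolventSymbol k * ‖waveBasis.repr g k‖) := by
      intro k _
      rw [h2, h1, repr_freeResolvent, norm_mul, norm_mul, norm_mul, norm_wave, Complex.norm_real,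
        Complex.norm_real, Real.norm_of_nonneg (resolventSymbol_pos k).le,
        Real.norm_of_nonneg (by positivity)]
      ring
    rw [Finset.sum_congr rfl h4, ← Finset.mul_sum, mul_assoc]
    refine mul_le_mul_of_nonneg_left ?_ (by positivity)
    refine (Real.sum_mul_le_sqrt_mul_sqrt s _ _).trans ?_
    have h5 : √(∑ k ∈ s, resolventSymbol k ^ 2) ≤ R :=
      Real.sqrt_le_sqrt (summable_resolventSymbol_sq.sum_le_tsum s fun k _ => by positivity)
    have h6 : √(∑ k ∈ s, ‖waveBasis.repr g k‖ ^ 2) ≤ ‖g‖ := by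
      refine Real.sqrt_le_iff.2 ⟨norm_nonneg _, ?_⟩
      exact sum_le_hasSum s (fun k _ => by positivity) (hasSum_norm_repr_sq waveBasis g)
    gcongr
  filter_upwards [hns, ae_all_iff.2 fun n => hpart (ns n)] with x h1 h2
  refine (le_of_tendsto h1.norm (Filter.Eventually.of_forall h2)).trans ?_
  nlinarith [norm_nonneg g]

/-! ### Multiplication operators -/

lemma exists_mulOp {W : Plane → ℝ}
    (hW : AEStronglyMeasurable W ((volume : Measure Plane).restrict cell)) {C : ℝ}
    (hC : ∀ᵐ x ∂(volume : Measure Plane).restrict cell, |W x| ≤ C) :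
    ∃ A : CellL2 →L[ℂ] CellL2,
      (∀ f : CellL2, A f =ᵐ[(volume : Measure Plane).restrict cell] fun x => (W x : ℂ) * f x) ∧
      ∀ f, ‖A f‖ ≤ C * ‖f‖ := by
  have hb : ∀ f : CellL2, ∀ᵐ x ∂(volume : Measure Plane).restrict cell,
      ‖(W x : ℂ) * f x‖ ≤ C * ‖f x‖ := fun f => by
    filter_upwards [hC] with x hx
    rw [norm_mul, Complex.norm_real]
    exact mul_le_mul_of_nonneg_right hx (norm_nonneg _)
  have hm : ∀ f : CellL2, MemLp (fun x => (W x : ℂ) * f x) 2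
      ((volume : Measure Plane).restrict cell) := fun f =>
    (Lp.memLp f).of_le_mul
      ((Complex.continuous_ofReal.comp_aestronglyMeasurable hW).mul (Lp.aestronglyMeasurable f)) (hb f)
  have hae : ∀ f : CellL2, (hm f).toLp _ =ᵐ[(volume : Measure Plane).restrict cell]
      fun x => (W x : ℂ) * f x := fun f => (hm f).coeFn_toLp
  let L : CellL2 →ₗ[ℂ] CellL2 :=
    { toFun := fun f => (hm f).toLp _
      map_add' := fun f g => Lp.ext (by
        filter_upwards [hae f, hae g, hae (f + g), Lp.coeFn_add f g,
          Lp.coeFn_add ((hm f).toLp _) ((hm g).toLp _)] with x h1 h2 h3 h4 h5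
        rw [h3, h4, h5, Pi.add_apply, Pi.add_apply, h1, h2, mul_add])
      map_smul' := fun c f => Lp.ext (by
        filter_upwards [hae f, hae (c • f), Lp.coeFn_smul c f,
          Lp.coeFn_smul c ((hm f).toLp _)] with x h1 h2 h3 h4
        rw [RingHom.id_apply, h2, h3, h4, Pi.smul_apply, Pi.smul_apply, h1, smul_eq_mul,
          smul_eq_mul, mul_left_comm]) }
  have hn : ∀ f, ‖L f‖ ≤ C * ‖f‖ := fun f => by
    refine Lp.norm_le_mul_norm_of_ae_le_mul ?_
    filter_upwards [hae f, hb f] with x h1 h2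
    exact (congrArg norm h1).le.trans h2
  exact ⟨L.mkContinuous C hn, hae, hn⟩

lemma inner_mulOp {W : Plane → ℝ} {A : CellL2 →L[ℂ] CellL2}
    (hA : ∀ f : CellL2, A f =ᵐ[(volume : Measure Plane).restrict cell] fun x => (W x : ℂ) * f x)
    (f g : CellL2) : inner ℂ (A f) g = inner ℂ f (A g) := by
  rw [L2.inner_def, L2.inner_def]
  refine integral_congr_ae ?_
  filter_upwards [hA f, hA g] with x h1 h2
  rw [h1, h2, RCLike.inner_apply, RCLike.inner_apply, map_mul, Complex.conj_ofReal]
  ring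

/-! ### The nonlinear potential -/

section Potential

variable {V : Plane → ℝ → ℝ} {VL K : Plane → ℝ}

/-- Smoothness is only known for `s ≥ 0`; the cutoff `max p.2 0` gives a function continuous on the
whole space. -/
lemma IsNonlinearPotential.continuous (hV : IsNonlinearPotential V VL K) :
    Continuous fun p : Plane × ℝ => V p.1 (max p.2 0) := by
  have h : Continuous fun p : Plane × ℝ => ((p.1, max p.2 0) : Plane × ℝ) := by fun_prop
  exact hV.smooth.continuousOn.comp_continuous h fun p => ⟨mem_univ _, le_max_right p.2 0⟩

lemma IsNonlinearPotential.continuous_left (hV : IsNonlinearPotential V VL K) {s : ℝ}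
    (hs : 0 ≤ s) : Continuous fun x => V x s := by
  have h := hV.continuous.comp (by fun_prop : Continuous fun x : Plane => ((x, s) : Plane × ℝ))
  simpa [Function.comp_def, max_eq_left hs] using h

lemma IsNonlinearPotential.linear_eq (hV : IsNonlinearPotential V VL K) (x : Plane) :
    VL x = V x 0 := by
  obtain ⟨r, hr, C, hC⟩ := hV.expansion
  have h := hC x 0 ⟨le_rfl, hr.le⟩
  have h2 : |V x 0 - VL x| ≤ 0 := by simpa using h
  linarith [abs_nonpos_iff.1 h2]

lemma IsNonlinearPotential.continuous_linear (hV : IsNonlinearPotential V VL K) :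
    Continuous VL := by
  rw [show VL = fun x => V x 0 from funext hV.linear_eq]
  exact hV.continuous_left le_rfl

lemma IsNonlinearPotential.exists_bound_linear (hV : IsNonlinearPotential V VL K) :
    ∃ C > 0, ∀ x, |VL x| ≤ C :=
  hV.honeycomb_linear.periodic.exists_bound hV.continuous_linear

/-- No regularity of `K` is assumed. Its bound is read off from the expansion at the single value `s
= r`, where all other terms are bounded. -/
lemma IsNonlinearPotential.exists_bound_kerr (hV : IsNonlinearPotential V VL K) :
    ∃ C > 0, ∀ x, |K x| ≤ C := by
  obtain ⟨r, hr, C, hC⟩ := hV.expansion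
  obtain ⟨B, hB0, hB⟩ := (hV.periodic r hr.le).exists_bound (hV.continuous_left hr.le)
  obtain ⟨B', hB0', hB'⟩ := hV.exists_bound_linear
  have hC0 : 0 ≤ C * r ^ 2 := (abs_nonneg _).trans (hC 0 r ⟨hr.le, le_rfl⟩)
  refine ⟨(B + B' + C * r ^ 2) / r, by positivity, fun x => ?_⟩
  rw [le_div_iff₀ hr]
  have h1 := hC x r ⟨hr.le, le_rfl⟩
  have h2 : ‖V x r‖ ≤ B := hB x
  have h3 := hB' x
  rw [Real.norm_eq_abs] at h2
  rw [← abs_of_pos hr, ← abs_mul, abs_of_pos hr, abs_le]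
  rw [abs_le] at h1 h2 h3
  constructor <;> linarith

/-- `K` is the pointwise limit of the continuous difference quotients `(V(x,s) - VL(x))/s` along `s
= r/(n+1)`. -/
lemma IsNonlinearPotential.measurable_kerr (hV : IsNonlinearPotential V VL K) : Measurable K := by
  obtain ⟨r, hr, C, hC⟩ := hV.expansion
  have hs : ∀ n : ℕ, r / (n + 1) ∈ Ioc 0 r := fun n =>
    ⟨by positivity, div_le_self hr.le (by linarith [(Nat.cast_nonneg n : (0 : ℝ) ≤ n)])⟩
  refine measurable_of_tendsto_metrizable
    (f := fun (n : ℕ) x => (V x (r / (n + 1)) - VL x) / (r / (n + 1))) (fun n => ?_) ?_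
  · exact ((hV.continuous_left (hs n).1.le).sub hV.continuous_linear).measurable.div_const _
  · rw [tendsto_pi_nhds]
    intro x
    rw [tendsto_iff_norm_sub_tendsto_zero]
    have hlim : Filter.Tendsto (fun n : ℕ => C * (r / ((n : ℝ) + 1))) Filter.atTop (nhds 0) := by
      have := (tendsto_one_div_add_atTop_nhds_zero_nat (𝕜 := ℝ)).const_mul (C * r)
      simpa [div_eq_mul_inv, mul_assoc] using this
    refine squeeze_zero (fun n => norm_nonneg _) (fun n => ?_) hlim
    have h1 := hC x _ ⟨(hs n).1.le, (hs n).2⟩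
    have h0 := (hs n).1
    generalize r / ((n : ℝ) + 1) = s at h0 h1
    have h2 : (V x s - VL x) / s - K x = (V x s - (VL x + K x * s)) / s := by
      field_simp; ring
    rw [h2, Real.norm_eq_abs, abs_div, abs_of_pos h0, div_le_iff₀ h0]
    linarith

lemma IsNonlinearPotential.aestronglyMeasurable_comp (hV : IsNonlinearPotential V VL K)
    {μ : Measure Plane} {f : Plane → ℂ} (hf : AEStronglyMeasurable f μ) :
    AEStronglyMeasurable (fun x => V x (‖f x‖ ^ 2)) μ := by
  have h : AEStronglyMeasurable (fun x => (x, ‖f x‖ ^ 2)) μ :=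
    aestronglyMeasurable_id.prodMk (hf.norm.pow 2)
  have h2 := hV.continuous.comp_aestronglyMeasurable h
  simpa [max_eq_left (sq_nonneg _)] using h2

end Potential

/-! ### Consequences of the rotation symmetry -/

lemma omega_pow_three : omega ^ 3 = 1 := by
  rw [omega, ← Complex.exp_nat_mul]
  convert Complex.exp_two_pi_mul_I using 2
  push_cast; ring

lemma norm_omega : ‖omega‖ = 1 := by
  rw [omega, show 2 * (Real.pi : ℂ) * Complex.I / 3 = ((2 * Real.pi / 3 : ℝ) : ℂ) * Complex.I by
    push_cast; ring, Complex.norm_exp_ofReal_mul_I]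

lemma omega_ne_one : omega ≠ 1 := by
  intro h
  rw [omega, Complex.exp_eq_one_iff] at h
  obtain ⟨n, hn⟩ := h
  have hpi : (2 * Real.pi * Complex.I : ℂ) ≠ 0 := Complex.two_pi_I_ne_zero
  have h1 : ((3 * n : ℤ) : ℂ) = ((1 : ℤ) : ℂ) := by
    push_cast
    apply mul_right_cancel₀ hpi
    linear_combination -3 * hn
  have h2 : 3 * n = 1 := by exact_mod_cast h1
  omega

lemma conj_omega_mul : conj omega * omega = 1 := by
  rw [← Complex.normSq_eq_conj_mul_self, Complex.normSq_eq_norm_sq, norm_omega]; simp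

lemma conj_omega : conj omega = omega ^ 2 := by
  have h := conj_omega_mul
  have h3 := omega_pow_three
  calc conj omega = conj omega * omega ^ 3 := by rw [h3, mul_one]
    _ = (conj omega * omega) * omega ^ 2 := by ring
    _ = omega ^ 2 := by rw [h, one_mul]

lemma omega_sq_ne_one : omega ^ 2 ≠ 1 := by
  intro h
  apply omega_ne_one
  calc omega = omega ^ 2 * omega := by rw [h, one_mul]
    _ = omega ^ 3 := by ring
    _ = 1 := omega_pow_three

/-- The integral is invariant under `R`, hence equal to `c` times itself. -/
lemma setIntegral_cell_eq_zero_of_rot {F : Plane → ℂ} (hF : LatticePeriodic F) {c : ℂ}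
    (hc : c ≠ 1) (h : ∀ᵐ x ∂(volume : Measure Plane), F (rot x) = c * F x) :
    ∫ x in cell, F x = 0 := by
  have h1 : ∫ x in cell, F (rot x) = c * ∫ x in cell, F x := by
    rw [← integral_const_mul]
    exact integral_congr_ae (ae_restrict_of_ae h)
  rw [setIntegral_cell_rot hF] at h1
  have h2 : (1 - c) * ∫ x in cell, F x = 0 := by linear_combination h1
  exact (mul_eq_zero.1 h2).resolve_left (sub_ne_zero.2 hc.symm)

/-- The Bloch phases in `rotOp` have modulus one and cancel in `f̄ g`, so such a product carries the
charge `σ̄ τ`. -/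
lemma MemRotSpace.conj_mul_rot {σ τ : ℂ} {f g : Plane → ℂ} (hf : MemRotSpace σ f)
    (hg : MemRotSpace τ g) : ∀ᵐ x ∂(volume : Measure Plane),
      conj (f (rot x)) * g (rot x) = conj σ * τ * (conj (f x) * g x) := by
  filter_upwards [hf.2, hg.2] with x h1 h2
  simp only [rotOp] at h1 h2
  have hp : conj (Complex.exp (-(Complex.I * (inner ℝ Kpt x : ℝ))) *
      Complex.exp (Complex.I * (inner ℝ Kpt (rot x) : ℝ))) *
      (Complex.exp (-(Complex.I * (inner ℝ Kpt x : ℝ))) *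
      Complex.exp (Complex.I * (inner ℝ Kpt (rot x) : ℝ))) = 1 := by
    rw [← Complex.exp_add, ← Complex.exp_conj, ← Complex.exp_add]
    rw [← Complex.exp_zero]
    congr 1
    simp only [map_add, map_neg, map_mul, Complex.conj_I, Complex.conj_ofReal]
    ring
  calc conj (f (rot x)) * g (rot x)
      = (conj (Complex.exp (-(Complex.I * (inner ℝ Kpt x : ℝ))) *
      Complex.exp (Complex.I * (inner ℝ Kpt (rot x) : ℝ))) *
      (Complex.exp (-(Complex.I * (inner ℝ Kpt x : ℝ))) *
      Complex.exp (Complex.I * (inner ℝ Kpt (rot x) : ℝ)))) *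
        (conj (f (rot x)) * g (rot x)) := by rw [hp, one_mul]
    _ = conj (Complex.exp (-(Complex.I * (inner ℝ Kpt x : ℝ))) *
      (Complex.exp (Complex.I * (inner ℝ Kpt (rot x) : ℝ)) * f (rot x))) *
      (Complex.exp (-(Complex.I * (inner ℝ Kpt x : ℝ))) *
      (Complex.exp (Complex.I * (inner ℝ Kpt (rot x) : ℝ)) * g (rot x))) := by
        simp only [map_mul]; ring
    _ = _ := by rw [h1, h2, map_mul]; ring

lemma LatticePeriodic.conj_mul {f g : Plane → ℂ} (hf : LatticePeriodic f) (hg : LatticePeriodic g) :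
    LatticePeriodic fun x => conj (f x) * g x := hf.map₂ hg fun a b => conj a * b

lemma inner2_eq_zero_of_rot {σ τ : ℂ} {f g : Plane → ℂ} (hf : MemRotSpace σ f)
    (hg : MemRotSpace τ g) (h : conj σ * τ ≠ 1) : inner2 f g = 0 :=
  setIntegral_cell_eq_zero_of_rot (hf.1.1.conj_mul hg.1.1) h (hf.conj_mul_rot hg)

/-- The density `K f̄₁ f₂ f̄₃ f₄`. -/
def quartic (K : Plane → ℝ) (f₁ f₂ f₃ f₄ : Plane → ℂ) (x : Plane) : ℂ :=
  K x * ((conj (f₁ x) * f₂ x) * (conj (f₃ x) * f₄ x))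

lemma integral_quartic_eq_zero {K : Plane → ℝ} (hK : IsHoneycomb K) {σ₁ σ₂ σ₃ σ₄ : ℂ}
    {f₁ f₂ f₃ f₄ : Plane → ℂ} (h₁ : MemRotSpace σ₁ f₁) (h₂ : MemRotSpace σ₂ f₂)
    (h₃ : MemRotSpace σ₃ f₃) (h₄ : MemRotSpace σ₄ f₄)
    (h : (conj σ₁ * σ₂) * (conj σ₃ * σ₄) ≠ 1) :
    ∫ x in cell, quartic K f₁ f₂ f₃ f₄ x = 0 := by
  refine setIntegral_cell_eq_zero_of_rot
    (hK.periodic.map₂ ((h₁.1.1.conj_mul h₂.1.1).map₂ (h₃.1.1.conj_mul h₄.1.1) (· * ·))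
      fun a b => (a : ℂ) * b) h ?_
  filter_upwards [h₁.conj_mul_rot h₂, h₃.conj_mul_rot h₄] with x h1 h2
  rw [quartic, h1, h2, hK.rot_invariant, quartic]
  ring

/-- A periodic square integrable function that is essentially bounded by `M`. -/
structure MemBounded (M : ℝ) (f : Plane → ℂ) : Prop where
  memL2 : MemL2 f
  bound : ∀ᵐ x ∂(volume : Measure Plane).restrict cell, ‖f x‖ ≤ M

/-! ### Quartic integrals and the projected cubic term -/

section Quartic

variable {K : Plane → ℝ} {κ M : ℝ}

lemma integrable_quartic (hK : Measurable K) (hκ : ∀ x, |K x| ≤ κ)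
    {f₁ f₂ f₃ f₄ : Plane → ℂ} (h₁ : MemBounded M f₁) (h₂ : MemBounded M f₂)
    (h₃ : MemBounded M f₃) (h₄ : MemBounded M f₄) :
    Integrable (quartic K f₁ f₂ f₃ f₄) ((volume : Measure Plane).restrict cell) := by
  have hc : ∀ {f : Plane → ℂ}, MemBounded M f → AEStronglyMeasurable (fun x => conj (f x))
      ((volume : Measure Plane).restrict cell) := fun h =>
    Complex.continuous_conj.comp_aestronglyMeasurable h.memL2.2.1
  have hm : AEStronglyMeasurable (quartic K f₁ f₂ f₃ f₄)
      ((volume : Measure Plane).restrict cell) :=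
    (Complex.continuous_ofReal.comp_aestronglyMeasurable hK.aestronglyMeasurable).mul
      (((hc h₁).mul h₂.memL2.2.1).mul ((hc h₃).mul h₄.memL2.2.1))
  refine Integrable.of_bound hm (κ * ((M * M) * (M * M))) ?_
  filter_upwards [h₁.bound, h₂.bound, h₃.bound, h₄.bound] with x b1 b2 b3 b4
  have hM : 0 ≤ M := (norm_nonneg _).trans b1
  have hk := hκ x
  have hκ0 : 0 ≤ κ := (abs_nonneg _).trans hk
  simp only [quartic, norm_mul, Complex.norm_real, Real.norm_eq_abs, RCLike.norm_conj]
  gcongr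

/-- The leading term of the projection of the nonlinearity to the ground state. -/
lemma integral_kerr_term (hK : Measurable K) (hκ : ∀ x, |K x| ≤ κ) (hs : IsHoneycomb K)
    {σ τ : ℂ} {f g : Plane → ℂ} (hf : MemBounded M f) (hg : MemBounded M g)
    (hfσ : MemRotSpace σ f) (hgτ : MemRotSpace τ g) (hσ : conj σ * σ = 1) (hτ : conj τ * τ = 1)
    (h1 : conj σ * τ ≠ 1) (h2 : (conj σ * τ) * (conj σ * τ) ≠ 1) (α β : ℂ) :
    ∫ x in cell, conj (f x) * (K x * (‖α * f x + β * g x‖ ^ 2 : ℝ) * (α * f x + β * g x))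
      = α * (‖α‖ ^ 2 * Ione K f + 2 * ‖β‖ ^ 2 * Iint K f g : ℝ) := by
  have h3 : conj τ * σ ≠ 1 := fun h => h1 (by
    have := congrArg conj h
    simpa [mul_comm] using this)
  -- The two terms on the first line of the result carry trivial charge. The factor `2` on the mixed
  -- one counts the two ways to obtain `α|β|²`.
  have hsplit : ∀ x, conj (f x) * (K x * (‖α * f x + β * g x‖ ^ 2 : ℝ) * (α * f x + β * g x))
      = α * (conj α * α) * quartic K f f f f x + 2 * (α * (conj β * β)) * quartic K f f g g x
        + (2 * (conj α * α * β) * quartic K f g f f x + (conj β * β * β) * quartic K f g g g x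
        + ((conj α * β ^ 2) * quartic K f g f g x + (conj β * α ^ 2) * quartic K g f f f x)) := by
    intro x
    have : ((‖α * f x + β * g x‖ ^ 2 : ℝ) : ℂ)
        = conj (α * f x + β * g x) * (α * f x + β * g x) := by
      rw [← Complex.normSq_eq_conj_mul_self, Complex.normSq_eq_norm_sq]
    rw [this]
    simp only [quartic, map_add, map_mul]
    ring
  have i1 := (integrable_quartic hK hκ hf hf hf hf).const_mul (α * (conj α * α))
  have i2 := (integrable_quartic hK hκ hf hf hg hg).const_mul (2 * (α * (conj β * β)))
  have i3 := (integrable_quartic hK hκ hf hg hf hf).const_mul (2 * (conj α * α * β))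
  have i4 := (integrable_quartic hK hκ hf hg hg hg).const_mul (conj β * β * β)
  have i5 := (integrable_quartic hK hκ hf hg hf hg).const_mul (conj α * β ^ 2)
  have i6 := (integrable_quartic hK hκ hg hf hf hf).const_mul (conj β * α ^ 2)
  -- The charges of the four remaining types are `σ̄τ`, `σ̄τ`, `(σ̄τ)²` and `τ̄σ`, all different
  -- from `1`.
  have z3 : ∫ x in cell, quartic K f g f f x = 0 :=
    integral_quartic_eq_zero hs hfσ hgτ hfσ hfσ (by rwa [hσ, mul_one])
  have z4 : ∫ x in cell, quartic K f g g g x = 0 :=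
    integral_quartic_eq_zero hs hfσ hgτ hgτ hgτ (by rwa [hτ, mul_one])
  have z5 : ∫ x in cell, quartic K f g f g x = 0 :=
    integral_quartic_eq_zero hs hfσ hgτ hfσ hgτ h2
  have z6 : ∫ x in cell, quartic K g f f f x = 0 :=
    integral_quartic_eq_zero hs hgτ hfσ hfσ hfσ (by rwa [hσ, mul_one])
  have v1 : ∫ x in cell, quartic K f f f f x = (Ione K f : ℂ) := by
    rw [Ione, ← integral_complex_ofReal]
    congr 1; ext x
    simp only [quartic, ← Complex.normSq_eq_conj_mul_self, Complex.normSq_eq_norm_sq]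
    push_cast; ring
  have v2 : ∫ x in cell, quartic K f f g g x = (Iint K f g : ℂ) := by
    rw [Iint, ← integral_complex_ofReal]
    congr 1; ext x
    simp only [quartic, ← Complex.normSq_eq_conj_mul_self, Complex.normSq_eq_norm_sq]
    push_cast; ring
  simp only [hsplit]
  rw [integral_add (i1.fun_add i2) ((i3.fun_add i4).fun_add (i5.fun_add i6)), integral_add i1 i2,
    integral_add (i3.fun_add i4) (i5.fun_add i6), integral_add i3 i4, integral_add i5 i6,
    integral_const_mul, integral_const_mul, integral_const_mul, integral_const_mul,
    integral_const_mul, integral_const_mul, z3, z4, z5, z6, v1, v2,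
    ← Complex.normSq_eq_conj_mul_self, ← Complex.normSq_eq_conj_mul_self,
    Complex.normSq_eq_norm_sq, Complex.normSq_eq_norm_sq]
  push_cast
  ring

end Quartic

lemma Ione_eq_of_reflect {K : Plane → ℝ} (hK : IsHoneycomb K) {f g : Plane → ℂ}
    (hg : LatticePeriodic g) (h : ∀ᵐ x ∂(volume : Measure Plane), f x = conj (g (-x))) :
    Ione K g = Ione K f := by
  have hp : LatticePeriodic fun x => K x * ‖g x‖ ^ 4 :=
    hK.periodic.map₂ hg fun a b => a * ‖b‖ ^ 4
  rw [Ione, ← setIntegral_cell_neg hp, Ione]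
  refine integral_congr_ae (ae_restrict_of_ae ?_)
  filter_upwards [h] with x hx
  rw [hx, hK.even, RCLike.norm_conj]

lemma Iint_comm (K : Plane → ℝ) (f g : Plane → ℂ) : Iint K f g = Iint K g f := by
  simp only [Iint, mul_comm (‖f _‖ ^ 2)]

/-! ### Perturbation of the ground state -/

section Perturbation

variable {H : Type*} [NormedAddCommGroup H] [InnerProductSpace ℂ H]

lemma norm_sq_smul_add_smul {x y : H} (hx : ‖x‖ = 1) (hy : ‖y‖ = 1) (hxy : inner ℂ x y = 0)
    (α β : ℂ) : ‖α • x + β • y‖ ^ 2 = ‖α‖ ^ 2 + ‖β‖ ^ 2 := by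
  have h : inner ℂ (α • x) (β • y) = 0 := by
    rw [inner_smul_left, inner_smul_right, hxy]; simp
  have := norm_add_sq_eq_norm_sq_add_norm_sq_of_inner_eq_zero (𝕜 := ℂ) _ _ h
  rw [norm_smul, norm_smul, hx, hy] at this
  nlinarith

lemma norm_sq_sub_projection {x y t : H} (hx : ‖x‖ = 1) (hy : ‖y‖ = 1) (hxy : inner ℂ x y = 0)
    {α β : ℂ} (hα : inner ℂ x t = α) (hβ : inner ℂ y t = β) :
    ‖t - (α • x + β • y)‖ ^ 2 = ‖t‖ ^ 2 - (‖α‖ ^ 2 + ‖β‖ ^ 2) := by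
  have hyx : inner ℂ y x = 0 := by rw [← inner_conj_symm, hxy, map_zero]
  have hxx : inner ℂ x x = 1 := by rw [inner_self_eq_norm_sq_to_K, hx]; simp
  have hyy : inner ℂ y y = 1 := by rw [inner_self_eq_norm_sq_to_K, hy]; simp
  have h : inner ℂ (α • x + β • y) (t - (α • x + β • y)) = 0 := by
    simp only [inner_add_left, inner_sub_right, inner_add_right, inner_smul_left,
      inner_smul_right, hα, hβ, hxy, hyx, hxx, hyy]
    ring
  have h2 := norm_add_sq_eq_norm_sq_add_norm_sq_of_inner_eq_zero (𝕜 := ℂ) _ _ h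
  rw [add_sub_cancel] at h2
  rw [← norm_sq_smul_add_smul hx hy hxy]
  nlinarith

/-- A perturbed eigenvector differs little from its projection to the ground state eigenspace. -/
lemma perturbed_eigenvector {G A : H →L[ℂ] H}
    (hG : ∀ f g, inner ℂ (G f) g = inner ℂ f (G g))
    (hA : ∀ f g, inner ℂ (A f) g = inner ℂ f (A g)) (hGn : ∀ g, ‖G g‖ ≤ ‖g‖)
    {ga gb : H} (ha : ga + A (G ga) = 0) (hb : gb + A (G gb) = 0)
    (na : ‖G ga‖ = 1) (nb : ‖G gb‖ = 1) (hab : inner ℂ (G ga) (G gb) = 0) {c : ℝ} (hc : 0 < c)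
    (hgap : ∀ g, inner ℂ (G ga) (G g) = 0 → inner ℂ (G gb) (G g) = 0 →
      ‖g‖ ≤ c * ‖g + A (G g)‖)
    {g w : H} {e : ℂ} (heq : g + A (G g) = e • G g - w) {η ε : ℝ} (hw : ‖w‖ ≤ η * ‖G g‖)
    (hη : 0 ≤ η) (he : ‖e‖ ≤ ε) (hsmall : c * (ε + η) ≤ 1 / 2) {α β : ℂ}
    (hα : inner ℂ (G ga) (G g) = α) (hβ : inner ℂ (G gb) (G g) = β) :
    inner ℂ (G ga) w = e * α ∧ inner ℂ (G gb) w = e * β ∧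
      ‖g - (α • ga + β • gb)‖ ≤ 2 * c * η * ‖α • G ga + β • G gb‖ := by
  have hba : inner ℂ (G gb) (G ga) = 0 := by rw [← inner_conj_symm, hab, map_zero]
  have haa : inner ℂ (G ga) (G ga) = 1 := by rw [inner_self_eq_norm_sq_to_K, na]; simp
  have hbb : inner ℂ (G gb) (G gb) = 1 := by rw [inner_self_eq_norm_sq_to_K, nb]; simp
  have ya := inner_add_comp_eq_zero hG hA ha g
  have yb := inner_add_comp_eq_zero hG hA hb g
  refine ⟨?_, ?_, ?_⟩
  · rw [heq, inner_sub_right, inner_smul_right, hα] at ya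
    exact (sub_eq_zero.1 ya).symm
  · rw [heq, inner_sub_right, inner_smul_right, hβ] at yb
    exact (sub_eq_zero.1 yb).symm
  set q : H := g - (α • ga + β • gb) with hq
  set u : H := α • G ga + β • G gb with hu
  set y : H := g + A (G g) with hy
  -- Subtracting kernel vectors leaves `y` unchanged and puts `q` in the domain of the gap estimate.
  have hGq : G q = G g - u := by simp [hq, hu]
  have hqy : q + A (G q) = y := by
    have h1 : q + A (G q) = y - (α • (ga + A (G ga)) + β • (gb + A (G gb))) := by
      rw [hGq]; simp only [hq, hu, hy, map_sub, map_add, map_smul]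
      module
    rw [h1, ha, hb]; simp
  have q1 : inner ℂ (G ga) (G q) = 0 := by
    rw [hGq, hu, inner_sub_right, inner_add_right, inner_smul_right, inner_smul_right, hα, haa, hab]
    ring
  have q2 : inner ℂ (G gb) (G q) = 0 := by
    rw [hGq, hu, inner_sub_right, inner_add_right, inner_smul_right, inner_smul_right, hβ, hbb, hba]
    ring
  have hgq := hgap q q1 q2
  rw [hqy] at hgq
  -- Orthogonality of `y` to `u` removes the term `e • u` from the bound on `y`. Otherwise an error
  -- `ε‖u‖` would appear in place of `η‖u‖`.
  have hyu : inner ℂ y u = 0 := by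
    rw [← inner_conj_symm, hu, inner_add_left, inner_smul_left, inner_smul_left, ya, yb]
    simp
  have hy1 : y = e • u + (e • G q - w) := by rw [hGq, heq]; module
  have hyy : ‖y‖ * ‖y‖ ≤ ‖y‖ * ‖e • G q - w‖ := by
    have h1 : inner ℂ y y = inner ℂ y (e • G q - w) := by
      have h := congrArg (inner ℂ y) hy1
      rwa [inner_add_right y (e • u), inner_smul_right, hyu, mul_zero, zero_add] at h
    have h2 : ‖y‖ * ‖y‖ = ‖inner ℂ y y‖ := by
      rw [inner_self_eq_norm_sq_to_K]; simp [sq]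
    rw [h2, h1]
    exact norm_inner_le_norm _ _
  have hyn : ‖y‖ ≤ ‖e • G q - w‖ := by
    rcases (norm_nonneg y).eq_or_lt with h | h
    · rw [← h]; exact norm_nonneg _
    · exact le_of_mul_le_mul_left hyy h
  have hGg : ‖G g‖ ≤ ‖u‖ + ‖q‖ := by
    have : G g = u + G q := by rw [hGq]; abel
    rw [this]
    exact (norm_add_le _ _).trans (by linarith [hGn q])
  have h3 : ‖e • G q - w‖ ≤ ε * ‖q‖ + η * (‖u‖ + ‖q‖) := by
    refine (norm_sub_le _ _).trans (add_le_add ?_ (hw.trans (by gcongr)))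
    rw [norm_smul]
    have := hGn q
    have := (norm_nonneg e).trans he
    gcongr
  -- The part proportional to `‖q‖` on the right is at most half of the left side by `hsmall` and is
  -- absorbed.
  have h4 : ‖q‖ ≤ c * (ε * ‖q‖ + η * (‖u‖ + ‖q‖)) :=
    hgq.trans (mul_le_mul_of_nonneg_left (hyn.trans h3) hc.le)
  have h5 : c * (ε + η) * ‖q‖ ≤ 1 / 2 * ‖q‖ := mul_le_mul_of_nonneg_right hsmall (norm_nonneg _)
  nlinarith

end Perturbation

/-! ### Integral estimates -/

lemma CellL2.integrable_norm_sq (f : CellL2) :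
    Integrable (fun x => ‖f x‖ ^ 2) ((volume : Measure Plane).restrict cell) :=
  (Lp.memLp f).norm.integrable_sq

lemma CellL2.integral_norm_sq (f : CellL2) : ∫ x in cell, ‖f x‖ ^ 2 = ‖f‖ ^ 2 := by
  have h1 : inner ℂ f f = ((‖f‖ ^ 2 : ℝ) : ℂ) := by
    rw [inner_self_eq_norm_sq_to_K]; norm_cast
  have h2 : inner ℂ f f = ((∫ x in cell, ‖f x‖ ^ 2 : ℝ) : ℂ) := by
    rw [L2.inner_def, ← integral_complex_ofReal]
    congr 1; ext x
    rw [inner_self_eq_norm_sq_to_K]; norm_cast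
  exact_mod_cast h2.symm.trans h1

lemma MemL2.norm_lp {f : Plane → ℂ} (hf : MemL2 f) : ‖hf.lp‖ = norm2 f := by
  rw [norm2, ← Real.sqrt_sq (norm_nonneg hf.lp), ← CellL2.integral_norm_sq]
  congr 1
  refine integral_congr_ae ?_
  filter_upwards [hf.coeFn_lp] with x hx
  rw [hx]

lemma MemL2.inner_lp {f g : Plane → ℂ} (hf : MemL2 f) (hg : MemL2 g) :
    inner ℂ hf.lp hg.lp = inner2 f g := by
  rw [inner2, L2.inner_def]
  refine integral_congr_ae ?_
  filter_upwards [hf.coeFn_lp, hg.coeFn_lp] with x h1 h2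
  rw [h1, h2, RCLike.inner_apply, mul_comm]

/-- Three replacements: the potential by its linear term in `‖t‖²`, then `‖t‖²` by `‖u‖²`, then `φ`
by `u`. The middle one uses Young's inequality with a free parameter `s`. The bound is quadratic in
`t`, `u` and `t - u`, so only their `L²` norms enter after integration. -/
lemma norm_kerr_difference_le {W k κ B₁ B₂ B₃ s : ℝ} {u t φ : ℂ}
    (hW : |W - k * ‖t‖ ^ 2| ≤ B₁ * ‖t‖ ^ 2) (hk : |k| ≤ κ) (hφ : ‖φ‖ ≤ B₂)
    (hq : ‖φ - u‖ ≤ B₃) (hs : 0 < s) :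
    ‖(W : ℂ) * φ - k * (‖u‖ ^ 2 : ℝ) * u‖ ≤ B₁ * B₂ * ‖t‖ ^ 2
      + (κ * B₂ * s + κ * B₃) * ‖u‖ ^ 2 + κ * B₂ * (1 + s⁻¹) * ‖t - u‖ ^ 2 := by
  have hκ : 0 ≤ κ := (abs_nonneg _).trans hk
  have hB₂ : 0 ≤ B₂ := (norm_nonneg _).trans hφ
  have hB₁ : 0 ≤ B₁ * ‖t‖ ^ 2 := (abs_nonneg _).trans hW
  have hsq : |‖t‖ ^ 2 - ‖u‖ ^ 2| ≤ s * ‖u‖ ^ 2 + (1 + s⁻¹) * ‖t - u‖ ^ 2 := by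
    have h1 := abs_norm_sub_norm_le t u
    have h2 : |‖t‖ ^ 2 - ‖u‖ ^ 2| = |‖t‖ - ‖u‖| * (‖t‖ + ‖u‖) := by
      rw [show ‖t‖ ^ 2 - ‖u‖ ^ 2 = (‖t‖ - ‖u‖) * (‖t‖ + ‖u‖) by ring, abs_mul,
        abs_of_nonneg (by positivity : 0 ≤ ‖t‖ + ‖u‖)]
    have h3 : ‖t‖ ≤ ‖u‖ + ‖t - u‖ := norm_le_norm_add_norm_sub' t u
    have h4 : 2 * ‖u‖ * ‖t - u‖ ≤ s * ‖u‖ ^ 2 + s⁻¹ * ‖t - u‖ ^ 2 := by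
      have h5 : 0 ≤ s⁻¹ * (s * ‖u‖ - ‖t - u‖) ^ 2 := by positivity
      have h6 : s⁻¹ * (s * ‖u‖ - ‖t - u‖) ^ 2
          = s * ‖u‖ ^ 2 + s⁻¹ * ‖t - u‖ ^ 2 - 2 * ‖u‖ * ‖t - u‖ := by
        field_simp; ring
      linarith
    rw [h2]
    calc |‖t‖ - ‖u‖| * (‖t‖ + ‖u‖) ≤ ‖t - u‖ * (2 * ‖u‖ + ‖t - u‖) :=
          mul_le_mul h1 (by linarith) (by positivity) (norm_nonneg _)
      _ ≤ _ := by nlinarith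
  have hdec : (W : ℂ) * φ - k * (‖u‖ ^ 2 : ℝ) * u
      = ((W - k * ‖t‖ ^ 2 : ℝ) : ℂ) * φ + (k : ℂ) * ((‖t‖ ^ 2 - ‖u‖ ^ 2 : ℝ) : ℂ) * φ
        + (k : ℂ) * (‖u‖ ^ 2 : ℝ) * (φ - u) := by
    push_cast; ring
  rw [hdec]
  refine (norm_add₃_le).trans ?_
  simp only [norm_mul, Complex.norm_real, Real.norm_eq_abs]
  rw [abs_of_nonneg (sq_nonneg ‖u‖)]
  have e1 : |W - k * ‖t‖ ^ 2| * ‖φ‖ ≤ B₁ * ‖t‖ ^ 2 * B₂ := by gcongr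
  have e2 : |k| * |‖t‖ ^ 2 - ‖u‖ ^ 2| * ‖φ‖
      ≤ κ * (s * ‖u‖ ^ 2 + (1 + s⁻¹) * ‖t - u‖ ^ 2) * B₂ := by gcongr
  have e3 : |k| * ‖u‖ ^ 2 * ‖φ - u‖ ≤ κ * ‖u‖ ^ 2 * B₃ := by gcongr
  linarith

/-- Replacing the nonlinearity by its leading term costs little. -/
lemma norm_inner_sub_integral_kerr_le {K W : Plane → ℝ} {κ M B₁ B₂ B₃ B₄ s : ℝ} (hK : Measurable K)
    (hκ : ∀ x, |K x| ≤ κ) {f : Plane → ℂ} (hf : MemBounded M f) {u t φ w : CellL2}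
    (hw : w =ᵐ[(volume : Measure Plane).restrict cell] fun x => (W x : ℂ) * φ x)
    (hW : ∀ᵐ x ∂(volume : Measure Plane).restrict cell,
      |W x - K x * ‖t x‖ ^ 2| ≤ B₁ * ‖t x‖ ^ 2)
    (hφ : ∀ᵐ x ∂(volume : Measure Plane).restrict cell, ‖φ x‖ ≤ B₂)
    (hq : ∀ᵐ x ∂(volume : Measure Plane).restrict cell, ‖φ x - u x‖ ≤ B₃)
    (hu : ∀ᵐ x ∂(volume : Measure Plane).restrict cell, ‖u x‖ ≤ B₄) (hs : 0 < s) :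
    ‖inner ℂ hf.memL2.lp w - ∫ x in cell, conj (f x) * (K x * (‖u x‖ ^ 2 : ℝ) * u x)‖
      ≤ M * (B₁ * B₂ * ‖t‖ ^ 2 + (κ * B₂ * s + κ * B₃) * ‖u‖ ^ 2
        + κ * B₂ * (1 + s⁻¹) * ‖t - u‖ ^ 2) := by
  have h1 : inner ℂ hf.memL2.lp w = ∫ x in cell, conj (f x) * w x := by
    rw [L2.inner_def]
    refine integral_congr_ae ?_
    filter_upwards [hf.memL2.coeFn_lp] with x hx
    rw [hx, RCLike.inner_apply, mul_comm]
  have hcm : AEStronglyMeasurable (fun x => conj (f x)) ((volume : Measure Plane).restrict cell) :=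
    Complex.continuous_conj.comp_aestronglyMeasurable hf.memL2.2.1
  have i1 : Integrable (fun x => conj (f x) * w x) ((volume : Measure Plane).restrict cell) := by
    refine (L2.integrable_inner (𝕜 := ℂ) hf.memL2.lp w).congr ?_
    filter_upwards [hf.memL2.coeFn_lp] with x hx
    rw [hx, RCLike.inner_apply, mul_comm]
  have i2 : Integrable (fun x => conj (f x) * (K x * (‖u x‖ ^ 2 : ℝ) * u x))
      ((volume : Measure Plane).restrict cell) := by
    refine Integrable.of_bound (hcm.mul ((Complex.continuous_ofReal.comp_aestronglyMeasurable
      hK.aestronglyMeasurable).mul (Complex.continuous_ofReal.comp_aestronglyMeasurable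
      ((Lp.aestronglyMeasurable u).norm.pow 2)) |>.mul (Lp.aestronglyMeasurable u)))
      (M * (κ * B₄ ^ 2 * B₄)) ?_
    filter_upwards [hf.bound, hu] with x b1 b2
    have hM : 0 ≤ M := (norm_nonneg _).trans b1
    have hκ0 : 0 ≤ κ := (abs_nonneg _).trans (hκ x)
    have hk := hκ x
    simp only [norm_mul, Complex.norm_real, Real.norm_eq_abs, RCLike.norm_conj]
    rw [abs_of_nonneg (sq_nonneg ‖u x‖)]
    gcongr
  have i3 := (((CellL2.integrable_norm_sq t).const_mul (B₁ * B₂)).fun_add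
    ((CellL2.integrable_norm_sq u).const_mul (κ * B₂ * s + κ * B₃))).fun_add
    ((CellL2.integrable_norm_sq (t - u)).const_mul (κ * B₂ * (1 + s⁻¹)))
  rw [h1, ← integral_sub i1 i2, ← CellL2.integral_norm_sq t, ← CellL2.integral_norm_sq u,
    ← CellL2.integral_norm_sq (t - u), ← integral_const_mul, ← integral_const_mul,
    ← integral_const_mul, ← integral_add ((CellL2.integrable_norm_sq t).const_mul _)
    ((CellL2.integrable_norm_sq u).const_mul _), ← integral_add
    (((CellL2.integrable_norm_sq t).const_mul _).fun_add ((CellL2.integrable_norm_sq u).const_mul _))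
    ((CellL2.integrable_norm_sq (t - u)).const_mul _), ← integral_const_mul]
  refine norm_integral_le_of_norm_le (i3.const_mul M) ?_
  filter_upwards [hf.bound, hw, hW, hφ, hq, Lp.coeFn_sub t u] with x b1 b2 b3 b4 b5 b6
  rw [← mul_sub, norm_mul, RCLike.norm_conj, b2, b6, Pi.sub_apply]
  exact mul_le_mul b1 (norm_kerr_difference_le b3 (hκ x) b4 b5 hs) (norm_nonneg _)
    ((norm_nonneg _).trans b1)

/-! ### Control of `(1 - Δ_K) f` by the `H²` norm -/

lemma normH2_sq (f : Plane → ℂ) : normH2 f ^ 2 = norm2 f ^ 2 + ∑ i, norm2 (weakPartial i f) ^ 2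
    + ∑ i, ∑ j, norm2 (weakPartial j (weakPartial i f)) ^ 2 := by
  rw [normH2, Real.sq_sqrt (by positivity)]

lemma norm2_le_normH2 (f : Plane → ℂ) : norm2 f ≤ normH2 f := by
  refine Real.le_sqrt_of_sq_le ?_
  rw [add_assoc]
  exact le_add_of_nonneg_right (by positivity)

lemma norm2_weakPartial_le (f : Plane → ℂ) (i : Fin 2) : norm2 (weakPartial i f) ≤ normH2 f := by
  have h1 := fun i => sq_nonneg (norm2 (weakPartial i f))
  have h2 := fun i j => sq_nonneg (norm2 (weakPartial j (weakPartial i f)))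
  have h0 := sq_nonneg (norm2 f)
  refine le_of_sq_le_sq ?_ (Real.sqrt_nonneg _)
  rw [normH2_sq]
  simp only [Fin.sum_univ_two]
  have h3 := h1 0
  have h4 := h1 1
  fin_cases i
  · simp only [Fin.zero_eta]
    linarith [h2 0 0, h2 0 1, h2 1 0, h2 1 1]
  · simp only [Fin.mk_one]
    linarith [h2 0 0, h2 0 1, h2 1 0, h2 1 1]

lemma norm2_weakPartial_weakPartial_le (f : Plane → ℂ) (i : Fin 2) :
    norm2 (weakPartial i (weakPartial i f)) ≤ normH2 f := by
  have h1 := fun i => sq_nonneg (norm2 (weakPartial i f))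
  have h2 := fun i j => sq_nonneg (norm2 (weakPartial j (weakPartial i f)))
  have h0 := sq_nonneg (norm2 f)
  refine le_of_sq_le_sq ?_ (Real.sqrt_nonneg _)
  rw [normH2_sq]
  simp only [Fin.sum_univ_two]
  have h3 := h1 0
  have h4 := h1 1
  fin_cases i
  · simp only [Fin.zero_eta]
    linarith [h2 0 1, h2 1 0, h2 1 1]
  · simp only [Fin.mk_one]
    linarith [h2 0 0, h2 0 1, h2 1 0]

lemma norm2_add_le {f g : Plane → ℂ} (hf : MemL2 f) (hg : MemL2 g) :
    norm2 (f + g) ≤ norm2 f + norm2 g := by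
  rw [← (hf.add hg).norm_lp, ← hf.norm_lp, ← hg.norm_lp]
  exact norm_add_le hf.lp hg.lp

lemma norm2_const_smul {f : Plane → ℂ} (hf : MemL2 f) (c : ℂ) :
    norm2 (c • f) = ‖c‖ * norm2 f := by
  rw [← (hf.const_smul c).norm_lp, ← hf.norm_lp]
  exact norm_smul c hf.lp

lemma exists_source_bound : ∃ B > 0, ∀ (f : Plane → ℂ) (hf : MemH2 f),
    ‖hf.source‖ ≤ B * normH2 f := by
  refine ⟨1 + ((1 + ‖2 * Complex.I * (Kpt 0 : ℂ)‖ + ‖-(Kpt 0 : ℂ) ^ 2‖)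
    + (1 + ‖2 * Complex.I * (Kpt 1 : ℂ)‖ + ‖-(Kpt 1 : ℂ) ^ 2‖)), by positivity, fun f hf => ?_⟩
  have hpart : ∀ i, norm2 (weakPartial i (weakPartial i f)
      + (2 * Complex.I * (Kpt i : ℂ)) • weakPartial i f + (-(Kpt i : ℂ) ^ 2) • f)
      ≤ (1 + ‖2 * Complex.I * (Kpt i : ℂ)‖ + ‖-(Kpt i : ℂ) ^ 2‖) * normH2 f := by
    intro i
    have m1 := (hf.weakPartial_first i).1
    have m2 := (hf.weakPartial_second i i).1
    refine (norm2_add_le (m2.add (m1.const_smul _)) (hf.memL2.const_smul _)).trans ?_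
    have h1 := norm2_add_le m2 (m1.const_smul (2 * Complex.I * (Kpt i : ℂ)))
    rw [norm2_const_smul m1] at h1
    rw [norm2_const_smul hf.memL2]
    have h2 := norm2_weakPartial_weakPartial_le f i
    have h3 := mul_le_mul_of_nonneg_left (norm2_weakPartial_le f i)
      (norm_nonneg (2 * Complex.I * (Kpt i : ℂ)))
    have h4 := mul_le_mul_of_nonneg_left (norm2_le_normH2 f) (norm_nonneg (-(Kpt i : ℂ) ^ 2))
    linarith
  have hmem : ∀ i, MemL2 (weakPartial i (weakPartial i f)
      + (2 * Complex.I * (Kpt i : ℂ)) • weakPartial i f + (-(Kpt i : ℂ) ^ 2) • f) := fun i =>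
    ((hf.weakPartial_second i i).1.add ((hf.weakPartial_first i).1.const_smul _)).add
      (hf.memL2.const_smul _)
  have hlap := norm2_add_le (hmem 0) (hmem 1)
  rw [← laplaceK_eq] at hlap
  have h1 : ‖hf.source‖ ≤ norm2 f + norm2 (laplaceK f) := by
    rw [← hf.memL2.norm_lp, ← hf.memL2_laplaceK.norm_lp]
    exact norm_sub_le _ _
  linarith [hpart 0, hpart 1, norm2_le_normH2 f]

lemma MemH2.coeFn_source {f : Plane → ℂ} (hf : MemH2 f) :
    hf.source =ᵐ[(volume : Measure Plane).restrict cell] fun x => f x - laplaceK f x := by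
  filter_upwards [Lp.coeFn_sub hf.memL2.lp hf.memL2_laplaceK.lp, hf.memL2.coeFn_lp,
    hf.memL2_laplaceK.coeFn_lp] with x h1 h2 h3
  rw [MemH2.source, h1, Pi.sub_apply, h2, h3]

lemma MemH2.memBounded {S : ℝ} (hS : ∀ g : CellL2,
    ∀ᵐ x ∂(volume : Measure Plane).restrict cell, ‖freeResolvent g x‖ ≤ S * ‖g‖)
    {f : Plane → ℂ} (hf : MemH2 f) : MemBounded (S * ‖hf.source‖) f := by
  refine ⟨hf.memL2, ?_⟩
  have h := hS hf.source
  rw [hf.freeResolvent_source] at h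
  filter_upwards [h, hf.memL2.coeFn_lp] with x h1 h2
  rwa [← h2]

/-! ### The eigenvalue equation in `L²` of the cell -/

section Eigenvalue

variable {VL : Plane → ℝ} {E₀ : ℝ} {A : CellL2 →L[ℂ] CellL2}

/-- Moving `VL - 1 - E₀` to the left and the rest of the potential to the right puts the eigenvalue
equation in the form required by `perturbed_eigenvector`. -/
lemma IsEigenfunction.source_eq (hA : ∀ f : CellL2,
      A f =ᵐ[(volume : Measure Plane).restrict cell] fun x => ((VL x - 1 - E₀ : ℝ) : ℂ) * f x)
    {W : Plane → ℝ} {E : ℂ} {f : Plane → ℂ} (hf : IsEigenfunction W E f) {w : CellL2}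
    (hw : w =ᵐ[(volume : Measure Plane).restrict cell]
      fun x => ((W x - VL x : ℝ) : ℂ) * hf.memH2.memL2.lp x) :
    hf.memH2.source + A (freeResolvent hf.memH2.source)
      = (E - E₀) • freeResolvent hf.memH2.source - w := by
  rw [hf.memH2.freeResolvent_source]
  set F := hf.memH2.memL2.lp with hF
  refine Lp.ext ?_
  filter_upwards [Lp.coeFn_add hf.memH2.source (A F), Lp.coeFn_sub ((E - E₀) • F) w,
    Lp.coeFn_smul (E - (E₀ : ℂ)) F, hA F, hw, hf.memH2.coeFn_source, hf.memH2.memL2.coeFn_lp,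
    ae_restrict_of_ae hf.eqn] with x h1 h2 h3 h4 h5 h6 h7 h8
  rw [h1, h2, Pi.add_apply, Pi.sub_apply, h3, Pi.smul_apply, h4, h5, h6, h7, smul_eq_mul]
  push_cast
  linear_combination h8

lemma IsEigenfunction.source_add_eq_zero (hA : ∀ f : CellL2,
      A f =ᵐ[(volume : Measure Plane).restrict cell] fun x => ((VL x - 1 - E₀ : ℝ) : ℂ) * f x)
    {f : Plane → ℂ} (hf : IsEigenfunction VL E₀ f) :
    hf.memH2.source + A (freeResolvent hf.memH2.source) = 0 := by
  have h := hf.source_eq hA (w := 0) (by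
    filter_upwards [Lp.coeFn_zero ℂ 2 ((volume : Measure Plane).restrict cell)] with x hx
    rw [hx]; simp)
  simpa using h

/-- Kernel vectors of `1 + A G` come from genuine eigenfunctions, so the spanning hypothesis on the
eigenspace applies to them. Periodicity carries the equation from the cell to the plane. -/
lemma exists_isEigenfunction_of_kernel (hVL : LatticePeriodic VL) (hA : ∀ f : CellL2,
      A f =ᵐ[(volume : Measure Plane).restrict cell] fun x => ((VL x - 1 - E₀ : ℝ) : ℂ) * f x)
    {g : CellL2} (hg : g + A (freeResolvent g) = 0) (hne : freeResolvent g ≠ 0) :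
    ∃ (f : Plane → ℂ) (hf : IsEigenfunction VL E₀ f), hf.memH2.memL2.lp = freeResolvent g := by
  obtain ⟨f, hf, rfl⟩ := exists_memH2_source_eq g
  rw [hf.freeResolvent_source] at hg hne
  refine ⟨f, ⟨hf, fun h0 => hne ?_, ?_⟩, hf.freeResolvent_source.symm⟩
  · rw [Lp.eq_zero_iff_ae_eq_zero]
    exact hf.memL2.coeFn_lp.trans (ae_restrict_of_ae h0)
  · refine ae_of_ae_cell
      ((hf.memL2_laplaceK.1.map₂ (hVL.map₂ hf.memL2.1 fun a b => (a, b)) fun l p =>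
        -l + (p.1 : ℂ) * p.2 = (E₀ : ℂ) * p.2)) ?_
    filter_upwards [Lp.coeFn_add hf.source (A hf.memL2.lp), hA hf.memL2.lp, hf.coeFn_source,
      hf.memL2.coeFn_lp, (Lp.eq_zero_iff_ae_eq_zero).1 hg] with x h1 h2 h3 h4 h5
    rw [h1, Pi.add_apply, h2, h3, h4] at h5
    push_cast at h5
    simp only [Pi.zero_apply] at h5
    linear_combination h5

lemma IsGroundPair.inner2_eq_zero {φa φb : Plane → ℂ} (h₀ : IsGroundPair VL E₀ φa φb) :
    inner2 φa φb = 0 := by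
  refine inner2_eq_zero_of_rot h₀.rot_a h₀.rot_b ?_
  rw [conj_omega]
  intro h
  apply omega_ne_one
  calc omega = omega * omega ^ 3 := by rw [omega_pow_three, mul_one]
    _ = omega ^ 2 * omega ^ 2 := by ring
    _ = 1 := h

lemma IsGroundPair.exists_gap {φa φb : Plane → ℂ} (h₀ : IsGroundPair VL E₀ φa φb)
    (hVL : LatticePeriodic VL) (hA : ∀ f : CellL2,
      A f =ᵐ[(volume : Measure Plane).restrict cell] fun x => ((VL x - 1 - E₀ : ℝ) : ℂ) * f x) :
    ∃ c > 0, ∀ g,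
      inner ℂ (freeResolvent h₀.eigen_a.memH2.source) (freeResolvent g) = 0 →
      inner ℂ (freeResolvent h₀.eigen_b.memH2.source) (freeResolvent g) = 0 →
      ‖g‖ ≤ c * ‖g + A (freeResolvent g)‖ := by
  refine Honeycomb.exists_gap inner_freeResolvent (inner_mulOp hA) isCompactOperator_freeResolvent
    (fun g => freeResolvent_injective) (h₀.eigen_a.source_add_eq_zero hA)
    (h₀.eigen_b.source_add_eq_zero hA) ?_ ?_ ?_ ?_
  · rw [MemH2.freeResolvent_source, MemL2.norm_lp, h₀.norm_a]
  · rw [MemH2.freeResolvent_source, MemL2.norm_lp, h₀.norm_b]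
  · rw [MemH2.freeResolvent_source, MemH2.freeResolvent_source, MemL2.inner_lp, h₀.inner2_eq_zero]
  · intro g hg
    rw [MemH2.freeResolvent_source, MemH2.freeResolvent_source]
    by_cases hne : freeResolvent g = 0
    · exact ⟨0, 0, by simp [hne]⟩
    · obtain ⟨f, hf, hfg⟩ := exists_isEigenfunction_of_kernel hVL hA hg hne
      obtain ⟨α, β, hαβ⟩ := h₀.span f hf
      refine ⟨α, β, ?_⟩
      rw [← hfg]
      refine Lp.ext ?_
      filter_upwards [hf.memH2.memL2.coeFn_lp, h₀.eigen_a.memH2.memL2.coeFn_lp,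
        h₀.eigen_b.memH2.memL2.coeFn_lp, ae_restrict_of_ae hαβ,
        Lp.coeFn_add (α • h₀.eigen_a.memH2.memL2.lp) (β • h₀.eigen_b.memH2.memL2.lp),
        Lp.coeFn_smul α h₀.eigen_a.memH2.memL2.lp,
        Lp.coeFn_smul β h₀.eigen_b.memH2.memL2.lp] with x h1 h2 h3 h4 h5 h6 h7
      rw [h1, h4, h5, Pi.add_apply, h6, h7, Pi.smul_apply, Pi.smul_apply, h2, h3, smul_eq_mul,
        smul_eq_mul]

end Eigenvalue

/-! ### The amplitude equations -/

/-- Multiplying the first equation by `β`, the second by `α` and subtracting eliminates `e`,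
whatever its value. Everything left has degree four in `N`. -/
lemma amplitude_bound {α β e ea eb : ℂ} {I₁ I₂ D N : ℝ} (hN : 0 < N)
    (hN2 : N ^ 2 = ‖α‖ ^ 2 + ‖β‖ ^ 2)
    (ha : e * α = α * (‖α‖ ^ 2 * I₁ + 2 * ‖β‖ ^ 2 * I₂ : ℝ) + ea)
    (hb : e * β = β * (‖β‖ ^ 2 * I₁ + 2 * ‖α‖ ^ 2 * I₂ : ℝ) + eb)
    (hea : ‖ea‖ ≤ D * N ^ 3) (heb : ‖eb‖ ≤ D * N ^ 3) :
    ‖α / N‖ * ‖β / N‖ * |‖α / N‖ ^ 2 - ‖β / N‖ ^ 2| * |I₁ - 2 * I₂| ≤ 2 * D := by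
  have h1 : α * β * ((‖α‖ ^ 2 - ‖β‖ ^ 2 : ℝ) : ℂ) * ((I₁ - 2 * I₂ : ℝ) : ℂ)
      = α * eb - β * ea := by
    push_cast at ha hb ⊢
    linear_combination (-β) * ha + α * hb
  have hα : ‖α‖ ≤ N := by
    refine le_of_sq_le_sq ?_ hN.le
    nlinarith [sq_nonneg ‖β‖]
  have hβ : ‖β‖ ≤ N := by
    refine le_of_sq_le_sq ?_ hN.le
    nlinarith [sq_nonneg ‖α‖]
  have h2 : ‖α‖ * ‖β‖ * |‖α‖ ^ 2 - ‖β‖ ^ 2| * |I₁ - 2 * I₂| ≤ 2 * D * N ^ 4 := by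
    have h3 := congrArg norm h1
    rw [norm_mul, norm_mul, norm_mul, Complex.norm_real, Complex.norm_real, Real.norm_eq_abs,
      Real.norm_eq_abs] at h3
    rw [h3]
    refine (norm_sub_le _ _).trans ?_
    rw [norm_mul, norm_mul]
    have h4 : ‖α‖ * ‖eb‖ ≤ N * (D * N ^ 3) := mul_le_mul hα heb (norm_nonneg _) hN.le
    have h5 : ‖β‖ * ‖ea‖ ≤ N * (D * N ^ 3) := mul_le_mul hβ hea (norm_nonneg _) hN.le
    linarith
  have h6 : |‖α‖ ^ 2 / N ^ 2 - ‖β‖ ^ 2 / N ^ 2| = |‖α‖ ^ 2 - ‖β‖ ^ 2| / N ^ 2 := by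
    rw [← sub_div, abs_div, abs_of_pos (by positivity : 0 < N ^ 2)]
  rw [norm_div, norm_div, Complex.norm_real, Real.norm_of_nonneg hN.le, div_pow, div_pow, h6]
  rw [show ‖α‖ / N * (‖β‖ / N) * (|‖α‖ ^ 2 - ‖β‖ ^ 2| / N ^ 2) * |I₁ - 2 * I₂|
    = ‖α‖ * ‖β‖ * |‖α‖ ^ 2 - ‖β‖ ^ 2| * |I₁ - 2 * I₂| / N ^ 4 by field_simp,
    div_le_iff₀ (by positivity)]
  exact h2

lemma exists_lt_of_mul_lt {x y z t : ℝ} (ht : 0 < t) (hx : 0 ≤ x) (hy : 0 ≤ y)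
    (h : x * y * z < t) :
    x < t ^ (1 / 3 : ℝ) ∨ y < t ^ (1 / 3 : ℝ) ∨ z < t ^ (1 / 3 : ℝ) := by
  by_contra! hcon
  obtain ⟨h1, h2, h3⟩ := hcon
  have hδ : 0 < t ^ (1 / 3 : ℝ) := Real.rpow_pos_of_pos ht _
  have hδ3 : t ^ (1 / 3 : ℝ) * t ^ (1 / 3 : ℝ) * t ^ (1 / 3 : ℝ) = t := by
    rw [← Real.rpow_add ht, ← Real.rpow_add ht]; norm_num
  have h4 : t ^ (1 / 3 : ℝ) * t ^ (1 / 3 : ℝ) * t ^ (1 / 3 : ℝ) ≤ x * y * z := by gcongr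
  linarith

lemma MemBounded.mono {M M' : ℝ} {f : Plane → ℂ} (h : MemBounded M f) (hM : M ≤ M') :
    MemBounded M' f := ⟨h.memL2, h.bound.mono fun _ hx => hx.trans hM⟩

lemma integral_kerr_sub_eq {K : Plane → ℝ} {κ M : ℝ} (hK : Measurable K) (hκ : ∀ x, |K x| ≤ κ)
    {f g : Plane → ℂ} (hf : MemBounded M f) (hg : MemBounded M g) :
    ∫ x in cell, K x * (‖f x‖ ^ 4 - 2 * ‖g x‖ ^ 2 * ‖f x‖ ^ 2)
      = Ione K f - 2 * Iint K f g := by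
  have hre : ∀ {h : Plane → ℂ}, MemBounded M h → ∀ x, (quartic K f f h h x).re
      = K x * (‖f x‖ ^ 2 * ‖h x‖ ^ 2) := by
    intro h _ x
    simp only [quartic, ← Complex.normSq_eq_conj_mul_self, Complex.normSq_eq_norm_sq]
    norm_cast
  have hint : ∀ {h : Plane → ℂ}, MemBounded M h → Integrable (fun x =>
      K x * (‖f x‖ ^ 2 * ‖h x‖ ^ 2)) ((volume : Measure Plane).restrict cell) := by
    intro h hh
    refine (integrable_quartic hK hκ hf hf hh hh).re.congr (Filter.Eventually.of_forall fun x => ?_)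
    exact hre hh x
  have i1 : Integrable (fun x => K x * ‖f x‖ ^ 4) ((volume : Measure Plane).restrict cell) := by
    refine (hint hf).congr (Filter.Eventually.of_forall fun x => ?_)
    ring
  rw [Ione, Iint, ← integral_const_mul, ← integral_sub i1 ((hint hg).const_mul 2)]
  congr 1; ext x; ring

/-- Each product that must differ from `1` is `ω` or `ω²`. These are the charge conditions of
`integral_kerr_term` for the pair `φa`, `φb` and for the swapped pair. -/
lemma omega_charge_ne_one :
    conj omega * conj omega ≠ 1 ∧ conj omega * conj omega * (conj omega * conj omega) ≠ 1 ∧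
      conj (conj omega) * omega ≠ 1 ∧
      conj (conj omega) * omega * (conj (conj omega) * omega) ≠ 1 ∧
      conj (conj omega) * conj omega = 1 := by
  have h3 := omega_pow_three
  have h1 := omega_ne_one
  have h2 := omega_sq_ne_one
  simp only [Complex.conj_conj]
  refine ⟨fun h => h1 ?_, fun h => h2 ?_, fun h => h2 ?_, fun h => h1 ?_, ?_⟩
  · rw [conj_omega] at h
    linear_combination h - omega * h3
  · rw [conj_omega] at h
    linear_combination h - (omega ^ 5 + omega ^ 2) * h3
  · linear_combination h
  · linear_combination h - omega * h3
  · rw [mul_comm]; exact conj_omega_mul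

lemma inner2_sub_left_eq {f g h : Plane → ℂ} (hf : MemL2 f) (hg : MemL2 g) (hh : MemL2 h)
    (h0 : inner2 (f - g) h = 0) : inner2 h f = inner2 h g := by
  rw [← (hf.sub hg).inner_lp hh, ← inner_conj_symm, map_eq_zero] at h0
  have h1 : (hf.sub hg).lp = hf.lp - hg.lp := rfl
  rw [h1, inner_sub_right, hh.inner_lp, hh.inner_lp, sub_eq_zero] at h0
  exact h0

lemma norm_inner2_comm {f g : Plane → ℂ} (hf : MemL2 f) (hg : MemL2 g) :
    ‖inner2 f g‖ = ‖inner2 g f‖ := by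
  rw [← hf.inner_lp hg, ← hg.inner_lp hf, norm_inner_symm]

lemma coeffNorm_sq (φa φb φ : Plane → ℂ) :
    coeffNorm φa φb φ ^ 2 = ‖inner2 φa φ‖ ^ 2 + ‖inner2 φb φ‖ ^ 2 := by
  rw [coeffNorm, Real.sq_sqrt (by positivity)]

set_option maxHeartbeats 800000 in
/-- The amplitude equations hold up to an error of relative size `ε²`. -/
lemma exists_amplitude_estimate {V : Plane → ℝ → ℝ} {VL K : Plane → ℝ}
    (hV : IsNonlinearPotential V VL K) {E₀ : ℝ} {φa φb : Plane → ℂ}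
    (h₀ : IsGroundPair VL E₀ φa φb) (C₀ : ℝ) :
    ∃ D ≥ 0, ∃ ε₀ > 0, ε₀ ≤ 1 ∧ ∀ ε : ℝ, 0 < ε → ε < ε₀ →
      ∀ φt : Plane → ℂ, MemH2 φt → normH2 φt ≤ C₀ * ε →
      ∀ (E : ℂ) (φ : Plane → ℂ), IsEigenfunction (fun x => V x (‖φt x‖ ^ 2)) E φ →
        ‖E - (E₀ : ℂ)‖ < ε → inner2 φa φ = inner2 φa φt → inner2 φb φ = inner2 φb φt →
        0 < coeffNorm φa φb φ → norm2 φt ^ 2 ≤ 2 * coeffNorm φa φb φ ^ 2 →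
        norm2 φt ^ 2 - coeffNorm φa φb φ ^ 2 ≤ 2 * ε ^ 4 * coeffNorm φa φb φ ^ 2 →
        ‖coeffA φa φb φ‖ * ‖coeffB φa φb φ‖ *
          |‖coeffA φa φb φ‖ ^ 2 - ‖coeffB φa φb φ‖ ^ 2| * |Ione K φa - 2 * Iint K φa φb|
          ≤ 2 * (D * ε ^ 2) := by
  obtain ⟨S, hS0, hS⟩ := exists_sobolev_bound
  obtain ⟨B, hB0, hB⟩ := exists_source_bound
  obtain ⟨κ, hκ0, hκ⟩ := hV.exists_bound_kerr
  obtain ⟨CL, -, hCL⟩ := hV.exists_bound_linear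
  obtain ⟨r, hr, C₅, hC₅⟩ := hV.expansion
  have hC₅0 : 0 ≤ C₅ := by
    have h := (abs_nonneg _).trans (hC₅ 0 r ⟨hr.le, le_rfl⟩)
    exact nonneg_of_mul_nonneg_left h (by positivity)
  have hKm := hV.measurable_kerr
  obtain ⟨A, hA, -⟩ := exists_mulOp (W := fun x => VL x - 1 - E₀) (C := CL + 1 + |E₀|)
    ((hV.continuous_linear.sub continuous_const).sub continuous_const).aestronglyMeasurable
    (Filter.Eventually.of_forall fun x => by
      have h1 := abs_sub (VL x - 1) E₀
      have h2 := abs_sub (VL x) 1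
      have h3 := hCL x
      rw [abs_one] at h2
      linarith)
  obtain ⟨c, hc0, hgap⟩ := h₀.exists_gap hV.honeycomb_linear.periodic hA
  have ea := h₀.eigen_a.source_add_eq_zero hA
  have eb := h₀.eigen_b.source_add_eq_zero hA
  have ba' := h₀.eigen_a.memH2.memBounded hS
  have bb' := h₀.eigen_b.memH2.memBounded hS
  have Ga := h₀.eigen_a.memH2.freeResolvent_source
  have Gb := h₀.eigen_b.memH2.freeResolvent_source
  have ma := h₀.eigen_a.memH2.memL2
  have mb := h₀.eigen_b.memH2.memL2
  generalize h₀.eigen_a.memH2.source = ga at *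
  generalize h₀.eigen_b.memH2.source = gb at *
  have na : ‖freeResolvent ga‖ = 1 := by rw [Ga, MemL2.norm_lp, h₀.norm_a]
  have nb : ‖freeResolvent gb‖ = 1 := by rw [Gb, MemL2.norm_lp, h₀.norm_b]
  have hab : inner ℂ (freeResolvent ga) (freeResolvent gb) = 0 := by
    rw [Ga, Gb, MemL2.inner_lp, h₀.inner2_eq_zero]
  obtain ⟨M, hM0, ba, bb⟩ : ∃ M ≥ 0, MemBounded M φa ∧ MemBounded M φb :=
    ⟨S * (‖ga‖ + ‖gb‖), by positivity,
      ba'.mono (mul_le_mul_of_nonneg_left (le_add_of_nonneg_right (norm_nonneg _)) hS0.le),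
      bb'.mono (mul_le_mul_of_nonneg_left (le_add_of_nonneg_left (norm_nonneg _)) hS0.le)⟩
  -- Four constants: `|φt| ≤ T ε`, the perturbation is at most `C₁ ε²`, `|φ - u| ≤ D₁ ε² N` and `|φ|
  -- ≤ D₂ N`.
  obtain ⟨T, hT⟩ : ∃ T, T = S * (B * |C₀|) + 1 := ⟨_, rfl⟩
  have hT0 : 0 < T := by rw [hT]; positivity
  obtain ⟨C₁, hC₁⟩ : ∃ C₁, C₁ = (κ + C₅ * r) * T ^ 2 := ⟨_, rfl⟩
  have hC₁0 : 0 < C₁ := by rw [hC₁]; positivity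
  obtain ⟨D₁, hD₁⟩ : ∃ D₁, D₁ = S * (2 * c * C₁) := ⟨_, rfl⟩
  have hD₁0 : 0 < D₁ := by rw [hD₁]; positivity
  obtain ⟨D₂, hD₂⟩ : ∃ D₂, D₂ = 2 * M + D₁ := ⟨_, rfl⟩
  have hD₂0 : 0 < D₂ := by rw [hD₂]; positivity
  refine ⟨M * (2 * C₅ * T ^ 2 * D₂ + (κ * D₂ + κ * D₁) + 4 * κ * D₂), by positivity,
    -- The second bound keeps `|φt|²` in the range of the expansion; the third gives the smallness
    -- used for absorption.
    min 1 (min (r / T ^ 2) (1 / (2 * c * (1 + C₁)))), by positivity, min_le_left _ _, ?_⟩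
  intro ε hε hεlt φt hφt hφtH E φ hφ hE hαt hβt hN hn1 hn2
  have hε1 : ε < 1 := hεlt.trans_le (min_le_left _ _)
  have hεsq : ε ^ 2 ≤ ε := pow_le_of_le_one hε.le hε1.le two_ne_zero
  have hεr : T ^ 2 * ε ^ 2 ≤ r := by
    have h1 : ε < r / T ^ 2 := hεlt.trans_le ((min_le_right _ _).trans (min_le_left _ _))
    rw [lt_div_iff₀ (by positivity)] at h1
    have h2 : T ^ 2 * ε ^ 2 ≤ T ^ 2 * ε := by gcongr
    linarith
  have hsmall : c * (ε + C₁ * ε ^ 2) ≤ 1 / 2 := by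
    have h1 : ε < 1 / (2 * c * (1 + C₁)) :=
      hεlt.trans_le ((min_le_right _ _).trans (min_le_right _ _))
    rw [lt_div_iff₀ (by positivity)] at h1
    have h2 : c * (ε + C₁ * ε ^ 2) ≤ c * (ε + C₁ * ε) := by gcongr
    have h3 : c * (ε + C₁ * ε) = ε * (2 * c * (1 + C₁)) / 2 := by ring
    linarith
  have hN2 := coeffNorm_sq φa φb φ
  rw [coeffA, coeffB]
  have mt := hφt.memL2
  have mφ := hφ.memH2.memL2
  -- the trial function is small
  have ht : ∀ᵐ x ∂(volume : Measure Plane).restrict cell, ‖φt x‖ ^ 2 ≤ T ^ 2 * ε ^ 2 := by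
    filter_upwards [(hφt.memBounded hS).bound] with x hx
    have h1 : ‖φt x‖ ≤ T * ε := by
      calc ‖φt x‖ ≤ S * (B * normH2 φt) := hx.trans (by gcongr; exact hB φt hφt)
        _ ≤ S * (B * (|C₀| * ε)) := by
          gcongr
          exact hφtH.trans (mul_le_mul_of_nonneg_right (le_abs_self _) hε.le)
        _ = T * ε - ε := by rw [hT]; ring
        _ ≤ T * ε := by linarith
    rw [← mul_pow]
    gcongr
  have hexp : ∀ᵐ x ∂(volume : Measure Plane).restrict cell,
      |(V x (‖φt x‖ ^ 2) - VL x) - K x * ‖φt x‖ ^ 2| ≤ C₅ * (T ^ 2 * ε ^ 2) * ‖φt x‖ ^ 2 := by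
    filter_upwards [ht] with x hx
    have h1 := hC₅ x (‖φt x‖ ^ 2) ⟨sq_nonneg _, hx.trans hεr⟩
    rw [sub_sub]
    refine h1.trans ?_
    rw [sq (‖φt x‖ ^ 2), ← mul_assoc]
    gcongr
  -- the perturbation operator
  obtain ⟨P, hP, hPn⟩ := exists_mulOp (W := fun x => V x (‖φt x‖ ^ 2) - VL x) (C := C₁ * ε ^ 2)
    ((hV.aestronglyMeasurable_comp mt.2.1).sub hV.continuous_linear.aestronglyMeasurable) (by
      filter_upwards [ht, hexp] with x h1 h2
      have h3 := abs_add_le ((V x (‖φt x‖ ^ 2) - VL x) - K x * ‖φt x‖ ^ 2) (K x * ‖φt x‖ ^ 2)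
      rw [sub_add_cancel, abs_mul, abs_of_nonneg (sq_nonneg ‖φt x‖)] at h3
      have h4 : |K x| * ‖φt x‖ ^ 2 ≤ κ * (T ^ 2 * ε ^ 2) := by
        have := hκ x
        gcongr
      have h5 : C₅ * (T ^ 2 * ε ^ 2) * ‖φt x‖ ^ 2 ≤ C₅ * (T ^ 2 * ε ^ 2) * r := by
        have := h1.trans hεr
        gcongr
      rw [hC₁]
      linarith)
  have Gφ := hφ.memH2.freeResolvent_source
  have heq := hφ.source_eq hA (hP mφ.lp)
  generalize hφ.memH2.source = g at *
  obtain ⟨pa, pb, pq⟩ := perturbed_eigenvector inner_freeResolvent (inner_mulOp hA)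
    norm_freeResolvent_le ea eb na nb hab hc0 hgap heq (η := C₁ * ε ^ 2) (ε := ε)
    (by rw [Gφ]; exact hPn _) (by positivity) hE.le hsmall (α := inner2 φa φ) (β := inner2 φb φ)
    (by rw [Ga, Gφ, ma.inner_lp mφ]) (by rw [Gb, Gφ, mb.inner_lp mφ])
  rw [Ga, Gb] at pq
  rw [Ga] at pa
  rw [Gb] at pb
  rw [Ga] at na hab
  rw [Gb] at nb hab
  generalize coeffNorm φa φb φ = N at *
  generalize inner2 φa φ = α at *
  generalize inner2 φb φ = β at *
  obtain ⟨u, hu⟩ : ∃ u : CellL2, u = α • ma.lp + β • mb.lp := ⟨_, rfl⟩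
  rw [← hu] at pq
  have hun : ‖u‖ ^ 2 = N ^ 2 := by rw [hu, norm_sq_smul_add_smul na nb hab, hN2]
  have hun' : ‖u‖ = N := by
    rw [← Real.sqrt_sq (norm_nonneg u), hun, Real.sqrt_sq hN.le]
  rw [hun'] at pq
  -- Pythagoras, because `φt` has the same coefficients `α`, `β` as `φ`.
  have hpn : ‖mt.lp - u‖ ^ 2 = norm2 φt ^ 2 - N ^ 2 := by
    rw [hu, norm_sq_sub_projection na nb hab (by rw [MemL2.inner_lp]; exact hαt.symm)
      (by rw [MemL2.inner_lp]; exact hβt.symm), mt.norm_lp, hN2]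
  have huae : ∀ᵐ x ∂(volume : Measure Plane).restrict cell, u x = α * φa x + β * φb x := by
    filter_upwards [Lp.coeFn_add (α • ma.lp) (β • mb.lp), Lp.coeFn_smul α ma.lp,
      Lp.coeFn_smul β mb.lp, ma.coeFn_lp, mb.coeFn_lp] with x h1 h2 h3 h4 h5
    rw [hu, h1, Pi.add_apply, h2, h3, Pi.smul_apply, Pi.smul_apply, h4, h5, smul_eq_mul,
      smul_eq_mul]
  have hαN : ‖α‖ ≤ N := le_of_sq_le_sq (hN2 ▸ le_add_of_nonneg_right (sq_nonneg ‖β‖)) hN.le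
  have hβN : ‖β‖ ≤ N := le_of_sq_le_sq (hN2 ▸ le_add_of_nonneg_left (sq_nonneg ‖α‖)) hN.le
  have hub : ∀ᵐ x ∂(volume : Measure Plane).restrict cell, ‖u x‖ ≤ 2 * M * N := by
    filter_upwards [huae, ba.bound, bb.bound] with x h1 h2 h3
    rw [h1]
    calc ‖α * φa x + β * φb x‖ ≤ ‖α‖ * ‖φa x‖ + ‖β‖ * ‖φb x‖ := by
          rw [← norm_mul, ← norm_mul]; exact norm_add_le _ _
      _ ≤ N * M + N * M := by gcongr
      _ = 2 * M * N := by ring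
  have hqb : ∀ᵐ x ∂(volume : Measure Plane).restrict cell,
      ‖mφ.lp x - u x‖ ≤ D₁ * ε ^ 2 * N := by
    have h1 : freeResolvent (g - (α • ga + β • gb)) = mφ.lp - u := by
      rw [map_sub, map_add, map_smul, map_smul, Ga, Gb, Gφ, hu]
    have h2 := hS (g - (α • ga + β • gb))
    rw [h1] at h2
    filter_upwards [h2, Lp.coeFn_sub mφ.lp u] with x h3 h4
    rw [← Pi.sub_apply, ← h4]
    refine h3.trans ((mul_le_mul_of_nonneg_left pq hS0.le).trans (le_of_eq ?_))
    rw [hD₁]; ring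
  have hφb : ∀ᵐ x ∂(volume : Measure Plane).restrict cell, ‖mφ.lp x‖ ≤ D₂ * N := by
    filter_upwards [hub, hqb] with x h1 h2
    have h3 := norm_le_norm_add_norm_sub' (mφ.lp x) (u x)
    have h4 : D₁ * ε ^ 2 * N ≤ D₁ * 1 * N := by
      have : ε ^ 2 ≤ 1 := pow_le_one₀ hε.le hε1.le
      gcongr
    rw [hD₂]
    linarith
  have hWt : ∀ᵐ x ∂(volume : Measure Plane).restrict cell,
      |(V x (‖φt x‖ ^ 2) - VL x) - K x * ‖mt.lp x‖ ^ 2|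
        ≤ C₅ * (T ^ 2 * ε ^ 2) * ‖mt.lp x‖ ^ 2 := by
    filter_upwards [hexp, mt.coeFn_lp] with x h1 h2
    rwa [h2]
  -- the error of the leading order approximation
  have herr : ∀ {f : Plane → ℂ} (hf : MemBounded M f),
      ‖inner ℂ hf.memL2.lp (P mφ.lp)
        - ∫ x in cell, conj (f x) * (K x * (‖u x‖ ^ 2 : ℝ) * u x)‖
      ≤ M * (2 * C₅ * T ^ 2 * D₂ + (κ * D₂ + κ * D₁) + 4 * κ * D₂) * ε ^ 2 * N ^ 3 := by
    intro f hf
    -- The choice `s = ε²` balances the two Young terms: `s‖u‖²` and `s⁻¹‖φt - u‖²` are both `O(ε²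
    -- N²)`.
    refine (norm_inner_sub_integral_kerr_le hKm hκ hf (hP mφ.lp) hWt hφb hqb hub
      (pow_pos hε 2)).trans ?_
    rw [hun, hpn, mt.norm_lp]
    have h1 : C₅ * (T ^ 2 * ε ^ 2) * (D₂ * N) * norm2 φt ^ 2
        ≤ C₅ * (T ^ 2 * ε ^ 2) * (D₂ * N) * (2 * N ^ 2) := by gcongr
    have h2 : κ * (D₂ * N) * (1 + (ε ^ 2)⁻¹) * (norm2 φt ^ 2 - N ^ 2)
        ≤ κ * (D₂ * N) * (1 + (ε ^ 2)⁻¹) * (2 * ε ^ 4 * N ^ 2) := by gcongr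
    have h3 : κ * (D₂ * N) * (1 + (ε ^ 2)⁻¹) * (2 * ε ^ 4 * N ^ 2)
        = 2 * κ * D₂ * N ^ 3 * (ε ^ 4 + ε ^ 2) := by
      field_simp
    have h4 : ε ^ 4 + ε ^ 2 ≤ 2 * ε ^ 2 := by
      have : ε ^ 4 ≤ ε ^ 2 := pow_le_pow_of_le_one hε.le hε1.le (by norm_num)
      linarith
    have h5 : 2 * κ * D₂ * N ^ 3 * (ε ^ 4 + ε ^ 2) ≤ 2 * κ * D₂ * N ^ 3 * (2 * ε ^ 2) := by
      gcongr
    calc _ ≤ M * (C₅ * (T ^ 2 * ε ^ 2) * (D₂ * N) * (2 * N ^ 2)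
          + (κ * (D₂ * N) * ε ^ 2 + κ * (D₁ * ε ^ 2 * N)) * N ^ 2
          + 2 * κ * D₂ * N ^ 3 * (2 * ε ^ 2)) := by
          refine mul_le_mul_of_nonneg_left ?_ hM0
          linarith
      _ = _ := by ring
  obtain ⟨z1, z2, z3, z4, z5⟩ := omega_charge_ne_one
  have la : ∫ x in cell, conj (φa x) * (K x * (‖u x‖ ^ 2 : ℝ) * u x)
      = α * (‖α‖ ^ 2 * Ione K φa + 2 * ‖β‖ ^ 2 * Iint K φa φb : ℝ) := by
    rw [← integral_kerr_term hKm hκ hV.honeycomb_kerr ba bb h₀.rot_a h₀.rot_b conj_omega_mul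
      (by rw [Complex.conj_conj, mul_comm]; exact conj_omega_mul) z1 z2]
    refine integral_congr_ae ?_
    filter_upwards [huae] with x hx
    rw [hx]
  have lb : ∫ x in cell, conj (φb x) * (K x * (‖u x‖ ^ 2 : ℝ) * u x)
      = β * (‖β‖ ^ 2 * Ione K φa + 2 * ‖α‖ ^ 2 * Iint K φa φb : ℝ) := by
    -- The reflection gives `φb` the same self-interaction integral as `φa`, so the second equation
    -- is the first with `α` and `β` exchanged.
    rw [← Ione_eq_of_reflect hV.honeycomb_kerr mb.1 h₀.reflect, Iint_comm K φa φb,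
      ← integral_kerr_term hKm hκ hV.honeycomb_kerr bb ba h₀.rot_b h₀.rot_a z5 conj_omega_mul z3 z4]
    refine integral_congr_ae ?_
    filter_upwards [huae] with x hx
    rw [hx, add_comm]
  have Ea := herr ba
  have Eb := herr bb
  rw [la] at Ea
  rw [lb] at Eb
  exact amplitude_bound hN hN2 (by rw [add_sub_cancel]; exact pa.symm)
    (by rw [add_sub_cancel]; exact pb.symm) Ea Eb

end Honeycomb

end

/-! ### The trichotomy -/

theorem mainTheorem2
    (V : Honeycomb.Plane → ℝ → ℝ) (VL K : Honeycomb.Plane → ℝ)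
    (hV : Honeycomb.IsNonlinearPotential V VL K)
    (E₀ : ℝ) (φa φb : Honeycomb.Plane → ℂ)
    (h₀ : Honeycomb.IsGroundPair VL E₀ φa φb)
    (hK : (∫ x in Honeycomb.cell, K x * (‖φa x‖ ^ 4 - 2 * ‖φb x‖ ^ 2 * ‖φa x‖ ^ 2)) ≠ 0)
    (C₀ : ℝ) :
    ∃ C > 0, ∃ ε₀ > 0, ∀ ε : ℝ, 0 < ε → ε < ε₀ →
      ∀ φt : Honeycomb.Plane → ℂ, Honeycomb.MemH2 φt →
        Honeycomb.norm2 φt < ε →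
        Honeycomb.normH2 φt ≤ C₀ * ε →
        1 - (‖Honeycomb.inner2 φt φa‖ ^ 2 + ‖Honeycomb.inner2 φt φb‖ ^ 2)
            / Honeycomb.norm2 φt ^ 2 < ε ^ 4 →
      ∀ (E : ℂ) (φ : Honeycomb.Plane → ℂ),
        Honeycomb.IsEigenfunction (fun x => V x (‖φt x‖ ^ 2)) E φ →
        ‖E - (E₀ : ℂ)‖ < ε →
        Honeycomb.inner2 (φ - φt) φa = 0 →
        Honeycomb.inner2 (φ - φt) φb = 0 →
        0 < Honeycomb.coeffNorm φa φb φ ∧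
        ∃ δ > 0,
          δ = |C * ε / (Honeycomb.Ione K φa - 2 * Honeycomb.Iint K φa φb)| ^ (1 / 3 : ℝ) ∧
          (‖Honeycomb.coeffA φa φb φ‖ < δ ∨ ‖Honeycomb.coeffB φa φb φ‖ < δ ∨
            |‖Honeycomb.coeffA φa φb φ‖ ^ 2 - ‖Honeycomb.coeffB φa φb φ‖ ^ 2| < δ) := by
  obtain ⟨D, hD, ε₁, hε₁, hε₁1, hest⟩ := Honeycomb.exists_amplitude_estimate hV h₀ C₀
  have hI : Honeycomb.Ione K φa - 2 * Honeycomb.Iint K φa φb ≠ 0 := by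
    obtain ⟨S, hS0, hS⟩ := Honeycomb.exists_sobolev_bound
    obtain ⟨κ, -, hκ⟩ := hV.exists_bound_kerr
    rwa [← Honeycomb.integral_kerr_sub_eq hV.measurable_kerr hκ
      ((h₀.eigen_a.memH2.memBounded hS).mono (le_max_left _ _))
      ((h₀.eigen_b.memH2.memBounded hS).mono (le_max_right _ _))]
  -- The `+ 1` makes `C` positive and the final comparison strict. With `ε < 1/2`, `ε⁴ ≤ 1/2`, so at
  -- least half of `‖φt‖²` lies in the eigenspace.
  refine ⟨2 * D + 1, by positivity, min ε₁ (1 / 2), by positivity, ?_⟩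
  intro ε hε hεlt φt hφt _ hφtH hproj E φ hφ hE hoa hob
  have hε1 : ε < ε₁ := hεlt.trans_le (min_le_left _ _)
  have hε2 : ε < 1 / 2 := hεlt.trans_le (min_le_right _ _)
  have ma := h₀.eigen_a.memH2.memL2
  have mb := h₀.eigen_b.memH2.memL2
  have hαt := Honeycomb.inner2_sub_left_eq hφ.memH2.memL2 hφt.memL2 ma hoa
  have hβt := Honeycomb.inner2_sub_left_eq hφ.memH2.memL2 hφt.memL2 mb hob
  have hN2 := Honeycomb.coeffNorm_sq φa φb φ
  rw [Honeycomb.norm_inner2_comm hφt.memL2 ma, Honeycomb.norm_inner2_comm hφt.memL2 mb, ← hαt,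
    ← hβt, ← hN2] at hproj
  have hε4 : ε ^ 4 ≤ 1 / 2 := by
    calc ε ^ 4 ≤ (1 / 2) ^ 4 := by gcongr
      _ ≤ 1 / 2 := by norm_num
  -- For `φt = 0` the quotient is `0` by convention, and the hypothesis would read `1 < ε⁴`.
  have hn0 : Honeycomb.norm2 φt ≠ 0 := by
    intro h
    rw [h] at hproj
    norm_num at hproj
    linarith
  have hn : 0 < Honeycomb.norm2 φt ^ 2 := by positivity
  rw [sub_lt_comm, lt_div_iff₀ hn] at hproj
  have hNnn : 0 ≤ Honeycomb.coeffNorm φa φb φ := Real.sqrt_nonneg _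
  have hN : 0 < Honeycomb.coeffNorm φa φb φ := by
    refine lt_of_le_of_ne hNnn fun h => ?_
    rw [← h] at hproj
    nlinarith
  have hn1 : Honeycomb.norm2 φt ^ 2 ≤ 2 * Honeycomb.coeffNorm φa φb φ ^ 2 := by nlinarith
  have hn2 : Honeycomb.norm2 φt ^ 2 - Honeycomb.coeffNorm φa φb φ ^ 2
      ≤ 2 * ε ^ 4 * Honeycomb.coeffNorm φa φb φ ^ 2 := by
    have := mul_le_mul_of_nonneg_left hn1 (pow_pos hε 4).le
    linarith
  have hmain := hest ε hε hε1 φt hφt hφtH E φ hφ hE hαt hβt hN hn1 hn2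
  have hI' : 0 < |Honeycomb.Ione K φa - 2 * Honeycomb.Iint K φa φb| := abs_pos.2 hI
  have hδ : 0 < |(2 * D + 1) * ε / (Honeycomb.Ione K φa - 2 * Honeycomb.Iint K φa φb)| :=
    abs_pos.2 (div_ne_zero (by positivity) hI)
  refine ⟨hN, _, Real.rpow_pos_of_pos hδ _, rfl, ?_⟩
  refine Honeycomb.exists_lt_of_mul_lt hδ (norm_nonneg _) (norm_nonneg _) ?_
  rw [abs_div, abs_of_pos (by positivity : 0 < (2 * D + 1) * ε), lt_div_iff₀ hI']
  refine hmain.trans_lt ?_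
  -- The amplitude estimate is of order `ε²`; the claim only needs order `ε`.
  have : D * ε ^ 2 ≤ D * ε := by
    have : ε ^ 2 ≤ ε := by nlinarith
    gcongr
  linarith
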